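/- Let $N,n,m$ be natural numbers. For $k=1,\dots,N$ let $H_k\in\mathbb R^{m\times n}$, $y_k\in\mathbb R^m$, let $Q_k^{1/2}\in\mathbb R^{n\times n}$ and $R_k^{1/2}\in\mathbb R^{m\times m}$ be roots of the (possibly singular) covariance matrices $Q_k,R_k$, that is $Q_k^{1/2}(Q_k^{1/2})^T=Q_k$ and $R_k^{1/2}(R_k^{1/2})^T=R_k$, let $G_k\in\mathbb R^{n\times n}$ for $k=2,\dots,N$, and let $x_0\in\mathbb R^n$. For $z=(u_1,t_1,x_1,\dots,u_N,t_N,x_N)$ with $u_k,x_k\in\mathbb R^n$, $t_k\in\mathbb R^m$, consider the singular Kalman smoothing problem $$\min_z\ \rho(z)\quad\text{s.t. } Az=\hat w,\qquad \rho(z)=\sum_{k=1}^N\rho_{1,k}(u_k)+\rho_{2,k}(t_k)+\rho_{3,k}(x_k),$$ where the penalties are extended-real-valued, $A$ is the block lower bidiagonal matrix with diagonal blocks $\begin{pmatrix}Q_k^{1/2}&0&I\\0&R_k^{1/2}&H_k\end{pmatrix}$ ($k=1,\dots,N$) and subdiagonal blocks $\begin{pmatrix}0&0&-G_{k}\\0&0&0\end{pmatrix}$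 in block rows $k=2,\dots,N$, and $\hat w=(x_0,y_1,0,y_2,\dots,0,y_N)$. Let $g$ be the indicator function of $\{z: Az=\hat w\}$ and $\rho^*$ the convex conjugate of $\rho$. Assume that $\rho$ is proper, convex and piecewise linear-quadratic (its effective domain is a finite union of polyhedral sets, relative to each of which $\rho$ has the form $\frac12\langle z,Pz\rangle+\langle a,z\rangle+\alpha$ with $P$ symmetric), that the problem has a minimizer with finite value, and that $0<\tau<1$, $0<\sigma<1$. From any starting pair $\eta^0=(z^0,\zeta^0)$, the Douglas–Rachford iteration $$z^{k}=\mathrm{prox}_{\tau g}(z^{k-1}-\tau\zeta^{k-1}),\qquad \zeta^{k}=\mathrm{prox}_{\sigma\rho^*}\big(\zeta^{k-1}+\sigma(2z^{k}-z^{k-1})\big),\qquad k\ge1,$$ where $\mathrm{prox}_{\alpha f}(v)=\arg\min_x \frac1{2\alpha}\|v-x\|^2+f(x)$, is well defined (each argmin exists and is unique). Write $\eta^k=(z^k,\zeta^k)$ and $$\|(z,\zeta)\|_{H-M}^2=\tfrac1\tau\|z\|^2-2\langle z,\zeta\rangle+\tfrac1\sigma\|\zeta\|^2 .$$ There are constants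 $R>0$, $\kappa\in(0,1)$ and $c>0$, independent of the starting pair, such that every sequence of iterates $(\eta^k)$ converges to a primal-dual solution $\eta^*=(z^*,\zeta^*)$, that is $-\zeta^*\in\partial g(z^*)$, $z^*\in\partial\rho^*(\zeta^*)$, and $z^*$ solves the problem; and, whenever $\|\eta^K-\eta^*\|<R$, for all $k\ge K$ $$\|\eta^{k+1}-\eta^*\|_{H-M}\le\kappa\,\|\eta^k-\eta^*\|_{H-M}\qquad\text{and}\qquad \|\eta^{k}-\eta^*\|\le c\,\kappa^{\,k-K}\,\|\eta^K-\eta^*\| .$$ -/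

import Mathlib

open Filter Topology

noncomputable section

/-! ### Convex analysis with extended-real-valued functions -/

section ConvexAnalysis

variable {E : Type*} [NormedAddCommGroup E] [InnerProductSpace ℝ E]

/-- A polyhedral set: a finite intersection of closed half-spaces. -/
def IsPolyhedral (C : Set E) : Prop :=
  ∃ (s : ℕ) (b : Fin s → E) (β : Fin s → ℝ), C = {x | ∀ j, inner ℝ (b j) x ≤ β j}

/-- Piecewise linear-quadratic functions: the effective domain is a union of finitely many
polyhedral sets, and relative to each of them `f x = ½⟨x, P x⟩ + ⟨a, x⟩ + α`
with `P` symmetric. -/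
def IsPLQ (f : E → EReal) : Prop :=
  ∃ (r : ℕ) (C : Fin r → Set E) (P : Fin r → (E →ₗ[ℝ] E)) (a : Fin r → E) (α : Fin r → ℝ),
    (∀ i, IsPolyhedral (C i)) ∧
    (∀ i, (P i).IsSymmetric) ∧
    {x | f x < ⊤} = ⋃ i, C i ∧
    ∀ i, ∀ x ∈ C i,
      f x = (((1 / 2 : ℝ) * inner ℝ x (P i x) + inner ℝ (a i) x + α i : ℝ) : EReal)

/-- `f` never takes the value `-∞` and is finite somewhere. -/
def IsProper (f : E → EReal) : Prop :=
  (∀ x, f x ≠ ⊥) ∧ ∃ x, f x ≠ ⊤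

/-- Convexity of an extended-real-valued function: its epigraph is convex. -/
def IsConvexFun (f : E → EReal) : Prop :=
  Convex ℝ {p : E × ℝ | f p.1 ≤ (p.2 : EReal)}

/-- The convex conjugate `f*(y) = sup_x ⟨y, x⟩ - f x`. -/
def conjugate (f : E → EReal) (y : E) : EReal :=
  ⨆ x, ((inner ℝ y x : ℝ) : EReal) - f x

/-- The convex subdifferential of `f` at `x`; it is empty where `f` is not finite. -/
def subdiff (f : E → EReal) (x : E) : Set E :=
  {v | f x ≠ ⊤ ∧ f x ≠ ⊥ ∧ ∀ y, f x + ((inner ℝ v (y - x) : ℝ) : EReal) ≤ f y}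

/-- `IsProx α f v p`: the point `p` is a minimizer of `x ↦ ‖v - x‖² / (2α) + f x`,
i.e. `p = prox_{αf}(v)`. -/
def IsProx (α : ℝ) (f : E → EReal) (v p : E) : Prop :=
  ∀ x, ((1 / (2 * α) * ‖v - p‖ ^ 2 : ℝ) : EReal) + f p
    ≤ ((1 / (2 * α) * ‖v - x‖ ^ 2 : ℝ) : EReal) + f x

end ConvexAnalysis

/-! ### The splitting iteration on primal-dual pairs `η = (z, ζ)` -/

section Splitting

/-- Pairs `η = (z, ζ)`, with the Euclidean norm `‖η‖² = ‖z‖² + ‖ζ‖²`. -/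
abbrev PrimalDual (E : Type*) := WithLp 2 (E × E)

variable {E : Type*} [NormedAddCommGroup E] [InnerProductSpace ℝ E]

/-- `η : ℕ → PrimalDual E` is a sequence of iterates of the Douglas-Rachford method for
`ρ + g`, with step sizes `τ`, `σ`:
`z⁺ = prox_{τg}(z - τζ)` and then `ζ⁺ = prox_{σρ*}(ζ + σ(2z⁺ - z))`. -/
def IsDRSRun (τ σ : ℝ) (g ρ : E → EReal) (η : ℕ → PrimalDual E) : Prop :=
  ∀ k, IsProx τ g ((η k).fst - τ • (η k).snd) (η (k + 1)).fst ∧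
    IsProx σ (conjugate ρ)
      ((η k).snd + σ • ((2 : ℝ) • (η (k + 1)).fst - (η k).fst)) (η (k + 1)).snd

/-- The set-valued operator `D (z, ζ) = ∂g(z) × ∂ρ*(ζ)`. -/
def opD (g ρ : E → EReal) (η : PrimalDual E) : Set (PrimalDual E) :=
  {v | v.fst ∈ subdiff g η.fst ∧ v.snd ∈ subdiff (conjugate ρ) η.snd}

/-- The skew operator `M (z, ζ) = (ζ, -z)`. -/
def opM (η : PrimalDual E) : PrimalDual E :=
  WithLp.toLp 2 (η.snd, -η.fst)

/-- The operator `H (z, ζ) = (z/τ, -2z + ζ/σ)`. -/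
def opH (τ σ : ℝ) (η : PrimalDual E) : PrimalDual E :=
  WithLp.toLp 2 (τ⁻¹ • η.fst, -((2 : ℝ) • η.fst) + σ⁻¹ • η.snd)

/-- The norm `‖η‖_{H-M} = ⟨η, (H - M)η⟩^{1/2}`. -/
def normHM (τ σ : ℝ) (η : PrimalDual E) : ℝ :=
  Real.sqrt (inner ℝ η (opH τ σ η - opM η))

/-- Primal-dual solutions: `0 ∈ (D + M) η`. -/
def IsPrimalDualSolution (g ρ : E → EReal) (η : PrimalDual E) : Prop :=
  ∃ v ∈ opD g ρ η, v + opM η = 0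

end Splitting

/-! ### The singular Kalman smoothing problem -/

/-- A linear state-space model with `N` time steps (numbered `0, …, N-1`), states in `ℝⁿ`
and observations in `ℝᵐ`. The covariances `Q k`, `R k` may be singular; they enter the
smoothing problem through roots `Qroot k`, `Rroot k`. The matrix `G 0` is not used, since
the first state is predicted by `x₀`. -/
structure KalmanModel (n m N : ℕ) where
  /-- initial state estimate -/
  x₀ : Fin n → ℝ
  /-- observations -/
  y : Fin N → Fin m → ℝ
  /-- process models -/
  G : Fin N → Matrix (Fin n) (Fin n) ℝ
  /-- observation models -/
  H : Fin N → Matrix (Fin m) (Fin n) ℝ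
  /-- process covariances -/
  Q : Fin N → Matrix (Fin n) (Fin n) ℝ
  /-- observation covariances -/
  R : Fin N → Matrix (Fin m) (Fin m) ℝ
  /-- root of `Q k` -/
  Qroot : Fin N → Matrix (Fin n) (Fin n) ℝ
  /-- root of `R k` -/
  Rroot : Fin N → Matrix (Fin m) (Fin m) ℝ
  Qroot_mul_transpose : ∀ k, Qroot k * (Qroot k).transpose = Q k
  Rroot_mul_transpose : ∀ k, Rroot k * (Rroot k).transpose = R k

/-- Indices of one stage `(u_k, t_k, x_k)` of the variable `z`. -/
abbrev StageIdx (n m : ℕ) := Fin n ⊕ (Fin m ⊕ Fin n)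

/-- The space of `z = (u_1, t_1, x_1, …, u_N, t_N, x_N)`. -/
abbrev ZSpace (n m N : ℕ) := EuclideanSpace ℝ (Fin N × StageIdx n m)

/-- The component `u_k` of `z`. -/
def ZSpace.u {n m N : ℕ} (z : ZSpace n m N) (k : Fin N) : EuclideanSpace ℝ (Fin n) :=
  WithLp.toLp 2 fun a => z (k, Sum.inl a)

/-- The component `t_k` of `z`. -/
def ZSpace.t {n m N : ℕ} (z : ZSpace n m N) (k : Fin N) : EuclideanSpace ℝ (Fin m) :=
  WithLp.toLp 2 fun b => z (k, Sum.inr (Sum.inl b))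

/-- The component `x_k` of `z`. -/
def ZSpace.x {n m N : ℕ} (z : ZSpace n m N) (k : Fin N) : EuclideanSpace ℝ (Fin n) :=
  WithLp.toLp 2 fun a => z (k, Sum.inr (Sum.inr a))

namespace KalmanModel

variable {n m N : ℕ} (S : KalmanModel n m N)

/-- The diagonal block `[Q_k^{1/2}, 0, I; 0, R_k^{1/2}, H_k]`. -/
def blockD (k : Fin N) : Matrix (Fin n ⊕ Fin m) (StageIdx n m) ℝ :=
  Matrix.fromBlocks (S.Qroot k) (Matrix.fromCols 0 1) 0 (Matrix.fromCols (S.Rroot k) (S.H k))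

/-- The block `[0, 0, -G_k; 0, 0, 0]`, which stands in block row `k`, left of the diagonal. -/
def blockB (k : Fin N) : Matrix (Fin n ⊕ Fin m) (StageIdx n m) ℝ :=
  Matrix.fromBlocks 0 (Matrix.fromCols 0 (-S.G k)) 0 0

/-- The block lower bidiagonal constraint matrix `A`. -/
def A : Matrix (Fin N × (Fin n ⊕ Fin m)) (Fin N × StageIdx n m) ℝ :=
  Matrix.of fun p q =>
    if q.1 = p.1 then S.blockD p.1 p.2 q.2
    else if (q.1 : ℕ) + 1 = p.1 then S.blockB p.1 p.2 q.2
    else 0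

/-- The right-hand side `ŵ = (x₀, y_1, 0, y_2, …, 0, y_N)`. -/
def w : Fin N × (Fin n ⊕ Fin m) → ℝ
  | (k, Sum.inl a) => if (k : ℕ) = 0 then S.x₀ a else 0
  | (k, Sum.inr b) => S.y k b

/-- The constraint `A z = ŵ`. -/
def Feasible (z : ZSpace n m N) : Prop :=
  S.A.mulVec z.ofLp = S.w

open Classical in
/-- The indicator function of the constraint `A z = ŵ`. -/
def g (z : ZSpace n m N) : EReal :=
  if S.Feasible z then 0 else ⊤

/-- `z` solves `min ρ(z)` subject to `A z = ŵ`, with a finite optimal value. -/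
def IsSolution (ρ : ZSpace n m N → EReal) (z : ZSpace n m N) : Prop :=
  S.Feasible z ∧ ρ z ≠ ⊤ ∧ ∀ z', S.Feasible z' → ρ z ≤ ρ z'

end KalmanModel

/-- The objective `ρ(z) = ∑ₖ ρ₁(u_k) + ρ₂(t_k) + ρ₃(x_k)`; the penalties may depend on the
stage `k`, as indicator functions of stage-dependent feasible regions do. -/
def objective {n m N : ℕ} (ρ₁ : Fin N → EuclideanSpace ℝ (Fin n) → EReal)
    (ρ₂ : Fin N → EuclideanSpace ℝ (Fin m) → EReal)
    (ρ₃ : Fin N → EuclideanSpace ℝ (Fin n) → EReal) (z : ZSpace n m N) : EReal :=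
  ∑ k, (ρ₁ k (z.u k) + ρ₂ k (z.t k) + ρ₃ k (z.x k))

end

/-! The iteration is a resolvent method for the monotone inclusion `0 ∈ (D + M) η`, and `τ * σ < 1`
makes `H - M` positive definite. Monotonicity makes the iterates Fejér monotone in that norm, with
the squared step length as gain (`IsResolventStep.fejer`). Local linear convergence then needs only
an error bound: once a step is short, its length bounds the distance to the solution set
(`fejer_linear_convergence`).

The error bound comes from polyhedrality. A subgradient of `ρ` at `x` is a vector lying in gradient
plus normal cone for every cell containing `x`. After fixing the signs of all cell inequalities and
adding multipliers, this is a linear system. Primal-dual solutions are the graph points of `∂ρ`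
satisfying the linear equation `L x = w`, `P ζ = 0`, with `P` the projection onto `ker L`, and a
short step yields a graph point with small residual. Hoffman's bound, applied to each of the
finitely many sign patterns, moves it to a solution (`Represents.exists_error_bound`). Patterns
incompatible with the equation have residuals bounded below, so the threshold and the constant
depend only on the problem, and so do `R`, `κ` and `c`.

There must also be a primal-dual solution. No constraint qualification is needed: Farkas' lemma
turns first-order optimality of the given minimizer into a subgradient orthogonal to `ker L`
(`Represents.exists_orthogonal_subgradient`). -/

/-! ### Linear inequalities -/

section LinearInequalities

variable {V : Type*} [AddCommGroup V] [Module ℝ V] {ι : Type*}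

/-- Induction on the number of inequalities: either the new one is redundant, or everything is
projected along a vector onto its kernel. Purely algebraic, so no closedness of finitely generated
cones is needed. -/
theorem exists_nonneg_combination_of_finset (s : Finset ι) (ℓ : ι → V →ₗ[ℝ] ℝ) (b : V →ₗ[ℝ] ℝ)
    (h : ∀ x, (∀ i ∈ s, ℓ i x ≤ 0) → b x ≤ 0) :
    ∃ c : ι → ℝ, (∀ i, 0 ≤ c i) ∧ b = ∑ i ∈ s, c i • ℓ i := by
  classical
  induction s using Finset.induction_on generalizing ℓ b with
  | empty =>
    refine ⟨0, fun _ => le_rfl, ?_⟩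
    ext x
    have h1 := h x (by simp)
    have h2 := h (-x) (by simp)
    simp only [map_neg] at h2
    simp; linarith
  | insert a s ha ih =>
    by_cases hs : ∀ x, (∀ i ∈ s, ℓ i x ≤ 0) → b x ≤ 0
    · obtain ⟨c, hc, hb⟩ := ih ℓ b hs
      refine ⟨Function.update c a 0, fun i => ?_, ?_⟩
      · by_cases hi : i = a
        · subst hi; simp
        · simpa [hi] using hc i
      · rw [Finset.sum_insert ha, hb]
        simp only [Function.update_self, zero_smul, zero_add]
        refine Finset.sum_congr rfl fun i hi => ?_
        have : i ≠ a := fun h => ha (h ▸ hi)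
        simp [this]
    · push Not at hs
      obtain ⟨x₁, hx₁, hbx₁⟩ := hs
      have hpos : 0 < ℓ a x₁ := by
        by_contra hneg
        have := h x₁ (by
          intro i hi
          rcases Finset.mem_insert.1 hi with rfl | hi
          · exact not_lt.1 hneg
          · exact hx₁ i hi)
        linarith
      -- Normalized so that `x - ℓ a x • x₀` lies in the kernel of `ℓ a`; the induction hypothesis
      -- is applied to the functionals composed with this projection.
      set x₀ := (ℓ a x₁)⁻¹ • x₁ with hx₀
      have ha1 : ℓ a x₀ = 1 := by simp [hx₀, hpos.ne']
      have hs0 : ∀ i ∈ s, ℓ i x₀ ≤ 0 := fun i hi => by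
        simp only [hx₀, map_smul, smul_eq_mul]
        exact mul_nonpos_of_nonneg_of_nonpos (inv_nonneg.2 hpos.le) (hx₁ i hi)
      have hb0 : 0 < b x₀ := by
        simp only [hx₀, map_smul, smul_eq_mul]; positivity
      obtain ⟨c, hc, hb⟩ := ih (fun i => ℓ i - ℓ i x₀ • ℓ a) (b - b x₀ • ℓ a) (by
        intro x hx
        have := h (x - ℓ a x • x₀) (by
          intro i hi
          rcases Finset.mem_insert.1 hi with rfl | hi
          · simp [ha1]
          · have := hx i hi
            simp only [LinearMap.sub_apply, LinearMap.smul_apply, smul_eq_mul] at this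
            simp only [map_sub, map_smul, smul_eq_mul]; linarith)
        simp only [map_sub, map_smul, smul_eq_mul] at this
        simp only [LinearMap.sub_apply, LinearMap.smul_apply, smul_eq_mul]; linarith)
      -- The coefficient of `ℓ a` is forced by evaluating at `x₀`; it is nonnegative because `b x₀ >
      -- 0` and every `ℓ i x₀ ≤ 0`.
      refine ⟨Function.update c a (b x₀ - ∑ i ∈ s, c i * ℓ i x₀), fun i => ?_, ?_⟩
      · by_cases hi : i = a
        · subst hi
          have : ∑ j ∈ s, c j * ℓ j x₀ ≤ 0 :=
            Finset.sum_nonpos fun j hj => mul_nonpos_of_nonneg_of_nonpos (hc j) (hs0 j hj)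
          simp only [Function.update_self]; linarith
        · simpa [hi] using hc i
      · rw [Finset.sum_insert ha]
        have : ∑ i ∈ s, Function.update c a (b x₀ - ∑ i ∈ s, c i * ℓ i x₀) i • ℓ i
            = ∑ i ∈ s, c i • ℓ i := by
          refine Finset.sum_congr rfl fun i hi => ?_
          have : i ≠ a := fun h => ha (h ▸ hi)
          simp [this]
        rw [this, Function.update_self]
        ext x
        have := congrArg (fun g : V →ₗ[ℝ] ℝ => g x) hb
        simp only [LinearMap.sub_apply, LinearMap.smul_apply, smul_eq_mul,
          LinearMap.sum_apply, mul_sub, Finset.sum_sub_distrib] at this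
        simp only [LinearMap.add_apply, LinearMap.smul_apply, smul_eq_mul,
          LinearMap.sum_apply, sub_mul, Finset.sum_mul]
        simp only [← mul_assoc] at this
        linarith

/-- Farkas' lemma. -/
theorem exists_nonneg_combination [Fintype ι] (ℓ : ι → V →ₗ[ℝ] ℝ) (b : V →ₗ[ℝ] ℝ)
    (h : ∀ x, (∀ i, ℓ i x ≤ 0) → b x ≤ 0) :
    ∃ c : ι → ℝ, (∀ i, 0 ≤ c i) ∧ b = ∑ i, c i • ℓ i :=
  exists_nonneg_combination_of_finset Finset.univ ℓ b fun x hx => h x fun i => hx i (by simp)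

/-- Farkas' alternative: an inconsistent system of linear inequalities has a certificate. -/
theorem exists_certificate_of_infeasible [Fintype ι] (ℓ : ι → V →ₗ[ℝ] ℝ) (c : ι → ℝ)
    (h : ¬ ∃ x, ∀ i, ℓ i x ≤ c i) :
    ∃ y : ι → ℝ, (∀ i, 0 ≤ y i) ∧ ∑ i, y i • ℓ i = 0 ∧ ∑ i, y i * c i < 0 := by
  -- Homogenization: a solution of the cone system with positive last coordinate would rescale to a
  -- solution of the original system.
  let L : Option ι → (V × ℝ) →ₗ[ℝ] ℝ := fun o =>
    o.elim (-LinearMap.snd ℝ V ℝ)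
      fun i => (ℓ i).comp (LinearMap.fst ℝ V ℝ) - c i • LinearMap.snd ℝ V ℝ
  obtain ⟨y, hy, hb⟩ := exists_nonneg_combination L (LinearMap.snd ℝ V ℝ) (by
    rintro ⟨x, s⟩ hx
    by_contra hs
    have hs : 0 < s := not_le.1 hs
    refine h ⟨s⁻¹ • x, fun i => ?_⟩
    have := hx (some i)
    simp only [L, Option.elim, LinearMap.sub_apply, LinearMap.comp_apply, LinearMap.fst_apply,
      LinearMap.smul_apply, LinearMap.snd_apply, smul_eq_mul] at this
    rw [map_smul, smul_eq_mul, inv_mul_le_iff₀ hs]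
    linarith)
  have key : ∀ x s, s = y none * (-s) + ∑ i, y (some i) * (ℓ i x - c i * s) := by
    intro x s
    have := congrArg (fun g : (V × ℝ) →ₗ[ℝ] ℝ => g (x, s)) hb
    simpa [L, Fintype.sum_option] using this
  refine ⟨fun i => y (some i), fun i => hy _, ?_, ?_⟩
  · ext x
    have := key x 0
    simp at this
    simp [← this]
  · have := key 0 1
    have h0 := hy none
    simp only [map_zero, mul_one, zero_sub, mul_neg, Finset.sum_neg_distrib] at this
    linarith

end LinearInequalities

/-! ### Polyhedra: normal cones and Hoffman's error bound -/

section Polyhedra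

variable {V : Type*} [NormedAddCommGroup V] [NormedSpace ℝ V] {ι : Type*}

theorem eventually_feasible_direction [Finite ι] {ℓ : ι → V →ₗ[ℝ] ℝ} {c : ι → ℝ} {p d : V}
    (hp : ∀ i, ℓ i p ≤ c i) (hd : ∀ i, ℓ i p = c i → ℓ i d ≤ 0) :
    ∀ᶠ t in 𝓝[>] (0 : ℝ), ∀ i, ℓ i (p + t • d) ≤ c i := by
  rw [Filter.eventually_all]
  intro i
  rcases (hp i).eq_or_lt with h | h
  · filter_upwards [self_mem_nhdsWithin] with t ht
    have := mul_nonpos_of_nonneg_of_nonpos (le_of_lt (show (0 : ℝ) < t from ht)) (hd i h)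
    simp only [map_add, map_smul, smul_eq_mul]; linarith
  · have hc : Continuous fun t : ℝ => ℓ i p + t * ℓ i d := by fun_prop
    have : ∀ᶠ t in 𝓝 (0 : ℝ), ℓ i p + t * ℓ i d < c i :=
      hc.continuousAt.eventually_lt continuousAt_const (by simpa using h)
    filter_upwards [nhdsWithin_le_nhds this] with t ht
    simp only [map_add, map_smul, smul_eq_mul]; linarith

/-- The normal cone of a polyhedral set is generated by the active constraints. -/
theorem exists_multipliers_of_normal [Fintype ι] {ℓ : ι → V →ₗ[ℝ] ℝ} {c : ι → ℝ} {p : V}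
    (v : V →ₗ[ℝ] ℝ) (hp : ∀ i, ℓ i p ≤ c i)
    (hv : ∀ w, (∀ i, ℓ i w ≤ c i) → v (w - p) ≤ 0) :
    ∃ y : ι → ℝ, (∀ i, 0 ≤ y i) ∧ (∀ i, ℓ i p ≠ c i → y i = 0) ∧ v = ∑ i, y i • ℓ i := by
  classical
  obtain ⟨y, hy, hb⟩ := exists_nonneg_combination_of_finset
    (Finset.univ.filter fun i => ℓ i p = c i) ℓ v (by
      intro d hd
      have h1 := eventually_feasible_direction (d := d) hp fun i hi => hd i (by simp [hi])
      obtain ⟨t, ht, ht0⟩ := (h1.and self_mem_nhdsWithin).exists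
      have := hv _ ht
      simp only [add_sub_cancel_left, map_smul, smul_eq_mul] at this
      by_contra hcon
      have : 0 < t * v d := mul_pos ht0 (not_le.1 hcon)
      linarith)
  refine ⟨fun i => if ℓ i p = c i then y i else 0, fun i => ?_, fun i hi => by simp [hi], ?_⟩
  · dsimp only; split_ifs
    · exact hy i
    · exact le_rfl
  · rw [hb, Finset.sum_filter]
    refine Finset.sum_congr rfl fun i _ => ?_
    split_ifs with h <;> simp [h]

/-- Elements of a finitely generated cone have nonnegative coefficients that are bounded
by a multiple of the norm. -/
theorem exists_bounded_nonneg_coefficients (s : Finset ι) (b : ι → V) :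
    ∃ C : ℝ, 0 ≤ C ∧ ∀ x : ι → ℝ, (∀ i, 0 ≤ x i) → ∃ y : ι → ℝ, (∀ i, 0 ≤ y i) ∧
      ∑ i ∈ s, y i • b i = ∑ i ∈ s, x i • b i ∧ ∑ i ∈ s, y i ≤ C * ‖∑ i ∈ s, x i • b i‖ := by
  classical
  induction s using Finset.strongInduction with
  | H s ih =>
    -- Carathéodory: independent generators determine the coefficients, with a bound from
    -- injectivity. Otherwise a linear relation removes one generator.
    by_cases hli : LinearIndependent ℝ fun i : s => b i
    · let L : (s → ℝ) →ₗ[ℝ] V := Fintype.linearCombination ℝ fun i : s => b i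
      have hker : LinearMap.ker L = ⊥ := by
        rw [LinearMap.ker_eq_bot]
        exact hli.fintypeLinearCombination_injective
      obtain ⟨K, -, hK⟩ := L.exists_antilipschitzWith hker
      refine ⟨s.card * K, by positivity, fun x hx => ⟨x, hx, rfl, ?_⟩⟩
      have hL : L (fun i : s => x i) = ∑ i ∈ s, x i • b i := by
        simp only [L, Fintype.linearCombination_apply]
        exact Finset.sum_coe_sort s fun i => x i • b i
      have h1 : ‖(fun i : s => x i)‖ ≤ K * ‖∑ i ∈ s, x i • b i‖ := by
        rw [← hL]; exact ZeroHomClass.bound_of_antilipschitz L hK _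
      calc ∑ i ∈ s, x i ≤ ∑ i ∈ s, ‖(fun i : s => x i)‖ := by
            refine Finset.sum_le_sum fun i hi => ?_
            exact (le_abs_self _).trans (norm_le_pi_norm (fun i : s => x i) ⟨i, hi⟩)
        _ ≤ s.card * K * ‖∑ i ∈ s, x i • b i‖ := by
            rw [Finset.sum_const, nsmul_eq_mul, mul_assoc]
            gcongr
    · choose! C hC0 hC using fun i (hi : i ∈ s) => ih (s.erase i) (Finset.erase_ssubset hi)
      refine ⟨∑ i ∈ s, C i, Finset.sum_nonneg hC0, fun x hx => ?_⟩
      obtain ⟨g, hg, k, hk⟩ : ∃ g : ι → ℝ, ∑ i ∈ s, g i • b i = 0 ∧ ∃ i ∈ s, 0 < g i := by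
        obtain ⟨g, hg, ⟨k, hk⟩, hgk⟩ := Fintype.not_linearIndependent_iff.1 hli
        let G : ι → ℝ := fun i => if h : i ∈ s then g ⟨i, h⟩ else 0
        have hG : ∑ i ∈ s, G i • b i = 0 := by
          rw [← hg, ← Finset.sum_coe_sort s fun i => G i • b i]
          refine Finset.sum_congr rfl fun i _ => by simp [G]
        have hGk : G k ≠ 0 := by simpa [G, hk] using hgk
        rcases hGk.lt_or_gt with h | h
        · refine ⟨-G, ?_, k, hk, by simpa using h⟩
          simp [hG]
        · exact ⟨G, hG, k, hk, h⟩
      -- Ratio test: subtracting the largest admissible multiple of the relation `g` kills the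
      -- coefficient at `m` and keeps the others nonnegative.
      obtain ⟨m, hm, hmin⟩ := Finset.exists_min_image (s.filter fun i => 0 < g i)
        (fun i => x i / g i) ⟨k, by simpa using hk⟩
      simp only [Finset.mem_filter] at hm hmin
      set t := x m / g m with ht
      have ht0 : 0 ≤ t := div_nonneg (hx m) hm.2.le
      have hx' : ∀ i, 0 ≤ if i ∈ s then x i - t * g i else 0 := fun i => by
        split_ifs with hi
        · rcases le_or_gt (g i) 0 with h | h
          · have := mul_nonpos_of_nonneg_of_nonpos ht0 h
            have := hx i
            linarith
          · have := (le_div_iff₀ h).1 (hmin i ⟨hi, h⟩)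
            linarith
        · exact le_rfl
      obtain ⟨y, hy0, hy, hyC⟩ := hC m hm.1 _ hx'
      have hsum : ∑ i ∈ s.erase m, (if i ∈ s then x i - t * g i else 0) • b i
          = ∑ i ∈ s, x i • b i := by
        have hz : ∑ i ∈ s, (x i - t * g i) • b i = ∑ i ∈ s, x i • b i := by
          simp only [sub_smul, mul_smul, Finset.sum_sub_distrib, ← Finset.smul_sum, hg]
          simp
        rw [← hz, ← Finset.add_sum_erase s _ hm.1]
        have : x m - t * g m = 0 := by rw [ht, div_mul_cancel₀ _ hm.2.ne', sub_self]
        rw [this, zero_smul, zero_add]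
        exact Finset.sum_congr rfl fun i hi => by rw [if_pos (Finset.mem_of_mem_erase hi)]
      rw [hsum] at hy hyC
      have hupd : ∀ i ∈ s.erase m, Function.update y m 0 i = y i := fun i hi => by
        simp [Finset.ne_of_mem_erase hi]
      refine ⟨Function.update y m 0, fun i => ?_, ?_, ?_⟩
      · by_cases hi : i = m
        · subst hi; simp
        · simpa [hi] using hy0 i
      · rw [← Finset.add_sum_erase s _ hm.1, ← hy]
        simp only [Function.update_self, zero_smul, zero_add]
        exact Finset.sum_congr rfl fun i hi => by rw [hupd i hi]
      · rw [← Finset.add_sum_erase s _ hm.1]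
        simp only [Function.update_self, zero_add]
        rw [Finset.sum_congr rfl hupd]
        refine hyC.trans ?_
        gcongr
        exact Finset.single_le_sum (f := C) hC0 hm.1

/-- Project `u` to `p`. The normal vector `u - p` is a combination of active constraints with total
weight at most a constant times `‖u - p‖`; pairing it with itself bounds `‖u - p‖ ^ 2` by this
weight times `e`. -/
theorem hoffman_of_feasible_inner {E : Type*} [NormedAddCommGroup E] [InnerProductSpace ℝ E]
    [FiniteDimensional ℝ E] [Fintype ι] (ℓ : ι → E →ₗ[ℝ] ℝ) (c : ι → ℝ)
    (hf : ∃ x, ∀ i, ℓ i x ≤ c i) :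
    ∃ C : ℝ, 0 ≤ C ∧ ∀ u e, 0 ≤ e → (∀ i, ℓ i u ≤ c i + e) →
      ∃ u', (∀ i, ℓ i u' ≤ c i) ∧ ‖u - u'‖ ≤ C * e := by
  classical
  -- The active set at the projection varies with `u`, so constants for all index sets are prepared
  -- and summed.
  choose C hC0 hC using fun s : Finset ι =>
    exists_bounded_nonneg_coefficients s fun i => (ℓ i).toContinuousLinearMap
  refine ⟨∑ s, C s, Finset.sum_nonneg fun s _ => hC0 s, fun u e he hu => ?_⟩
  let S : Set E := {x | ∀ i, ℓ i x ≤ c i}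
  have hScl : IsClosed S := by
    simp only [S, Set.ofPred_forall]
    exact isClosed_iInter fun i =>
      isClosed_le (ℓ i).continuous_of_finiteDimensional continuous_const
  have hSconv : Convex ℝ S := by
    simp only [S, Set.ofPred_forall]
    exact convex_iInter fun i => convex_halfSpace_le (ℓ i).isLinear _
  obtain ⟨p, hpS, hp⟩ := exists_norm_eq_iInf_of_complete_convex (K := S) hf hScl.isComplete hSconv u
  rw [norm_eq_iInf_iff_real_inner_le_zero hSconv hpS] at hp
  obtain ⟨y, hy0, hyact, hy⟩ := exists_multipliers_of_normal (innerₗ E (u - p)) hpS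
    fun w hw => hp w hw
  let s : Finset ι := Finset.univ.filter fun i => ℓ i p = c i
  obtain ⟨z, hz0, hz, hzC⟩ := hC s y hy0
  have hsum : ∑ i ∈ s, y i • (ℓ i).toContinuousLinearMap = innerSL ℝ (u - p) := by
    ext x
    have := congrArg (fun g : E →ₗ[ℝ] ℝ => g x) hy
    simp only [innerₗ_apply_apply, LinearMap.sum_apply, LinearMap.smul_apply] at this
    simp only [sum_apply, innerSL_apply_apply, this]
    rw [Finset.sum_filter]
    refine Finset.sum_congr rfl fun i _ => ?_
    split_ifs with h
    · rfl
    · simp [hyact i h]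
  rw [hsum] at hz hzC
  rw [innerSL_apply_norm] at hzC
  refine ⟨p, hpS, ?_⟩
  have h1 : ‖u - p‖ * ‖u - p‖ ≤ (C s * e) * ‖u - p‖ := by
    have h2 := congrArg (fun g : E →L[ℝ] ℝ => g (u - p)) hz
    simp only [sum_apply, innerSL_apply_apply] at h2
    rw [← real_inner_self_eq_norm_mul_norm, ← h2]
    calc _ ≤ ∑ i ∈ s, z i * e := by
          refine Finset.sum_le_sum fun i hi => ?_
          have hi' : ℓ i p = c i := by simpa [s] using hi
          have := hu i
          have h4 : ℓ i (u - p) ≤ e := by rw [map_sub]; linarith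
          exact mul_le_mul_of_nonneg_left h4 (hz0 i)
      _ = (∑ i ∈ s, z i) * e := by rw [Finset.sum_mul]
      _ ≤ (C s * ‖u - p‖) * e := by gcongr
      _ = _ := by ring
  have h3 : ‖u - p‖ ≤ C s * e := by
    rcases (norm_nonneg (u - p)).eq_or_lt with h | h
    · rw [← h]; exact mul_nonneg (hC0 s) he
    · exact le_of_mul_le_mul_right h1 h
  refine h3.trans ?_
  gcongr
  exact Finset.single_le_sum (f := C) (fun s _ => hC0 s) (Finset.mem_univ s)

/-- Hoffman's error bound, including the fact that an almost feasible system is feasible. -/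
theorem hoffman [FiniteDimensional ℝ V] [Finite ι] (ℓ : ι → V →ₗ[ℝ] ℝ) (c : ι → ℝ) :
    ∃ ε C : ℝ, 0 < ε ∧ 0 ≤ C ∧ ∀ u e, 0 ≤ e → e < ε → (∀ i, ℓ i u ≤ c i + e) →
      ∃ u', (∀ i, ℓ i u' ≤ c i) ∧ ‖u - u'‖ ≤ C * e := by
  have := Fintype.ofFinite ι
  by_cases hf : ∃ x, ∀ i, ℓ i x ≤ c i
  · let T : V ≃L[ℝ] _ := toEuclidean
    obtain ⟨C, hC0, hC⟩ := hoffman_of_feasible_inner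
      (fun i => (ℓ i).comp T.symm.toLinearEquiv.toLinearMap) c (by
        obtain ⟨x, hx⟩ := hf
        exact ⟨T x, fun i => by simpa [T] using hx i⟩)
    refine ⟨1, ‖T.symm.toContinuousLinearMap‖ * C, one_pos, by positivity, fun u e he _ hu => ?_⟩
    obtain ⟨u', hu', hd⟩ := hC (T u) e he (by simpa using hu)
    refine ⟨T.symm u', by simpa using hu', ?_⟩
    have h1 : u - T.symm u' = T.symm (T u - u') := by simp
    rw [h1, mul_assoc]
    exact (T.symm.toContinuousLinearMap.le_opNorm _).trans (by gcongr)
  · obtain ⟨y, hy0, hy, hyc⟩ := exists_certificate_of_infeasible ℓ c hf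
    have hS : 0 ≤ ∑ i, y i := Finset.sum_nonneg fun i _ => hy0 i
    -- Weighting the inequalities at `u` by the certificate gives `0 ≤ ∑ y i * c i + e * ∑ y i`,
    -- impossible for `e` below this threshold.
    refine ⟨-(∑ i, y i * c i) / (1 + ∑ i, y i), 0, div_pos (by linarith) (by linarith), le_rfl,
      fun u e he heε hu => ?_⟩
    exfalso
    rw [lt_div_iff₀ (by linarith)] at heε
    have h1 : ∑ i, y i * ℓ i u = 0 := by
      simpa using congrArg (fun g : V →ₗ[ℝ] ℝ => g u) hy
    have h2 : ∑ i, y i * ℓ i u ≤ ∑ i, y i * (c i + e) :=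
      Finset.sum_le_sum fun i _ => mul_le_mul_of_nonneg_left (hu i) (hy0 i)
    simp only [mul_add, Finset.sum_add_distrib, ← Finset.sum_mul] at h2
    nlinarith

/-- Hoffman's error bound for a system of inequalities and a vector equation. -/
theorem hoffman_with_equation {Y : Type*} [NormedAddCommGroup Y] [NormedSpace ℝ Y]
    [FiniteDimensional ℝ Y] [FiniteDimensional ℝ V] [Finite ι] (ℓ : ι → V →ₗ[ℝ] ℝ) (c : ι → ℝ)
    (Φ : V →ₗ[ℝ] Y) (d : Y) :
    ∃ ε C : ℝ, 0 < ε ∧ 0 ≤ C ∧ ∀ u, (∀ i, ℓ i u ≤ c i) → ‖Φ u - d‖ < ε →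
      ∃ u', (∀ i, ℓ i u' ≤ c i) ∧ Φ u' = d ∧ ‖u - u'‖ ≤ C * ‖Φ u - d‖ := by
  let T : Y ≃L[ℝ] _ := toEuclidean
  let π : Fin (Module.finrank ℝ Y) → Y →ₗ[ℝ] ℝ := fun k =>
    (EuclideanSpace.proj k : _ →L[ℝ] ℝ).toLinearMap.comp T.toLinearEquiv.toLinearMap
  have hπ : ∀ k y, |π k y| ≤ ‖T.toContinuousLinearMap‖ * ‖y‖ := fun k y =>
    (PiLp.norm_apply_le (T y) k).trans (T.toContinuousLinearMap.le_opNorm y)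
  have hπ0 : ∀ y, (∀ k, π k y = 0) → y = 0 := fun y hy => by
    apply T.injective
    ext k
    simpa [π] using hy k
  -- Each coordinate of the equation becomes two opposite inequalities.
  obtain ⟨ε, C, hε, hC0, hC⟩ := hoffman
    (Sum.elim ℓ (Sum.elim (fun k => (π k).comp Φ) fun k => -(π k).comp Φ))
    (Sum.elim c (Sum.elim (fun k => π k d) fun k => -π k d))
  set M := ‖T.toContinuousLinearMap‖ with hM
  have hM0 : 0 ≤ M := norm_nonneg _
  refine ⟨ε / (M + 1), C * M, by positivity, by positivity, fun u hu hd => ?_⟩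
  rw [lt_div_iff₀ (by linarith)] at hd
  have hn := norm_nonneg (Φ u - d)
  obtain ⟨u', hu', hdist⟩ := hC u (M * ‖Φ u - d‖) (by positivity) (by nlinarith) (by
    have hk : ∀ k, |π k (Φ u) - π k d| ≤ M * ‖Φ u - d‖ := fun k => by
      rw [← map_sub]; exact hπ k _
    rintro (i | k | k)
    · simp only [Sum.elim_inl]; have := hu i; nlinarith
    · simp only [Sum.elim_inl, Sum.elim_inr, LinearMap.comp_apply]
      have := (abs_le.1 (hk k)).2; linarith
    · simp only [Sum.elim_inr, LinearMap.comp_apply, LinearMap.neg_apply]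
      have := (abs_le.1 (hk k)).1; linarith)
  refine ⟨u', fun i => hu' (Sum.inl i), ?_, by rwa [mul_assoc]⟩
  refine sub_eq_zero.1 (hπ0 _ fun k => ?_)
  have h1 := hu' (Sum.inr (Sum.inl k))
  have h2 := hu' (Sum.inr (Sum.inr k))
  simp only [Sum.elim_inl, Sum.elim_inr, LinearMap.comp_apply, LinearMap.neg_apply] at h1 h2
  rw [map_sub]
  linarith

end Polyhedra

/-! ### Subgradients, proximal points and conjugates -/

section ConvexFunctions

variable {E : Type*} [NormedAddCommGroup E] [InnerProductSpace ℝ E] {F : E → EReal}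

theorem exists_real_of_ne {a : EReal} (h₁ : a ≠ ⊥) (h₂ : a ≠ ⊤) : ∃ r : ℝ, a = r :=
  ⟨a.toReal, (EReal.coe_toReal h₂ h₁).symm⟩

theorem mem_subdiff_iff (hF : ∀ x, F x ≠ ⊥) {x v : E} {r : ℝ} (hr : F x = r) :
    v ∈ subdiff F x ↔ ∀ (y : E) (s : ℝ), F y = s → r + inner ℝ v (y - x) ≤ s := by
  simp only [subdiff, Set.mem_ofPred_eq, hr]
  constructor
  · rintro ⟨-, -, h⟩ y s hs
    have := h y
    rw [hs] at this
    exact_mod_cast this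
  · intro h
    refine ⟨EReal.coe_ne_top _, EReal.coe_ne_bot _, fun y => ?_⟩
    by_cases hy : F y = ⊤
    · simp [hy]
    · obtain ⟨s, hs⟩ := exists_real_of_ne (hF y) hy
      rw [hs]
      exact_mod_cast h y s hs

theorem exists_value_of_mem_subdiff {x v : E} (h : v ∈ subdiff F x) : ∃ r : ℝ, F x = r :=
  exists_real_of_ne h.2.1 h.1

theorem subdiff_monotone (hF : ∀ x, F x ≠ ⊥) {x y v w : E} (hv : v ∈ subdiff F x)
    (hw : w ∈ subdiff F y) : 0 ≤ inner ℝ (v - w) (x - y) := by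
  obtain ⟨r, hr⟩ := exists_value_of_mem_subdiff hv
  obtain ⟨s, hs⟩ := exists_value_of_mem_subdiff hw
  have h1 := (mem_subdiff_iff hF hr).1 hv y s hs
  have h2 := (mem_subdiff_iff hF hs).1 hw x r hr
  simp only [inner_sub_left, inner_sub_right] at h1 h2 ⊢
  linarith

/-- The graph of the subdifferential of a closed function is closed. -/
theorem mem_subdiff_of_tendsto (hF : IsProper F)
    (hcl : IsClosed {p : E × ℝ | F p.1 ≤ (p.2 : EReal)}) {x v : ℕ → E} {x₀ v₀ : E}
    (hx : Tendsto x atTop (𝓝 x₀)) (hv : Tendsto v atTop (𝓝 v₀))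
    (h : ∀ k, v k ∈ subdiff F (x k)) : v₀ ∈ subdiff F x₀ := by
  -- The subgradient inequality itself bounds `F (x k)` above by a convergent quantity, so
  -- closedness of the epigraph suffices.
  have key : ∀ y (s : ℝ), F y = s → F x₀ ≤ ((s + inner ℝ v₀ (x₀ - y) : ℝ) : EReal) := by
    intro y s hs
    have hlim : Tendsto (fun k => (x k, s + inner ℝ (v k) (x k - y))) atTop
        (𝓝 (x₀, s + inner ℝ v₀ (x₀ - y))) :=
      hx.prodMk_nhds ((hv.inner (hx.sub_const y)).const_add s)
    refine hcl.mem_of_tendsto hlim (Eventually.of_forall fun k => ?_)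
    obtain ⟨r, hr⟩ := exists_value_of_mem_subdiff (h k)
    have := (mem_subdiff_iff hF.1 hr).1 (h k) y s hs
    have hle : r ≤ s + inner ℝ (v k) (x k - y) := by
      simp only [inner_sub_right] at this ⊢; linarith
    show F (x k) ≤ _
    rw [hr]
    exact_mod_cast hle
  obtain ⟨y, hy⟩ := hF.2
  obtain ⟨s, hs⟩ := exists_real_of_ne (hF.1 y) hy
  have htop : F x₀ ≠ ⊤ := ne_top_of_le_ne_top (EReal.coe_ne_top _) (key y s hs)
  obtain ⟨r, hr⟩ := exists_real_of_ne (hF.1 x₀) htop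
  rw [mem_subdiff_iff hF.1 hr]
  intro z q hq
  have := key z q hq
  rw [hr] at this
  have : r ≤ q + inner ℝ v₀ (x₀ - z) := by exact_mod_cast this
  simp only [inner_sub_right] at this ⊢; linarith

/-- An affine minorant makes the sublevel set of the proximal objective, taken inside the epigraph,
compact. Working on the epigraph replaces lower semicontinuity of `F` by continuity of `φ`. -/
theorem exists_isProx [FiniteDimensional ℝ E] (hF : IsProper F)
    (hcl : IsClosed {p : E × ℝ | F p.1 ≤ (p.2 : EReal)}) {a : E} {β : ℝ}
    (hminor : ∀ (x : E) (t : ℝ), F x ≤ t → inner ℝ a x + β ≤ t) {α : ℝ} (hα : 0 < α) (v : E) :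
    ∃ p, IsProx α F v p := by
  obtain ⟨x₀, hx₀⟩ := hF.2
  obtain ⟨r₀, hr₀⟩ := exists_real_of_ne (hF.1 x₀) hx₀
  let φ : E × ℝ → ℝ := fun p => 1 / (2 * α) * ‖v - p.1‖ ^ 2 + p.2
  have hφ : Continuous φ := by fun_prop
  set φ₀ := φ (x₀, r₀) with hφ₀
  let K : Set (E × ℝ) := {p | F p.1 ≤ (p.2 : EReal)} ∩ {p | φ p ≤ φ₀}
  have hKcl : IsClosed K := hcl.inter (isClosed_le hφ continuous_const)
  set M := φ₀ - β - inner ℝ a v with hM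
  -- Beyond this radius the quadratic term exceeds `‖a‖ * ‖v - x‖ + |M|`, hence the slack left by
  -- the minorant.
  set B := max 1 (2 * α * (‖a‖ + |M|)) with hB
  have hlow : ∀ x, inner ℝ a v - ‖a‖ * ‖v - x‖ ≤ inner ℝ a x := fun x => by
    have := real_inner_le_norm a (v - x)
    rw [inner_sub_right] at this; linarith
  have hKsub : K ⊆ Metric.closedBall v B ×ˢ Set.Icc (inner ℝ a v - ‖a‖ * B + β) φ₀ := by
    rintro ⟨x, t⟩ ⟨h1, h2⟩
    have h1' := hminor x t h1
    have h2' : 1 / (2 * α) * ‖v - x‖ ^ 2 + t ≤ φ₀ := h2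
    have h3 := hlow x
    have hs := norm_nonneg (v - x)
    have hxB : ‖v - x‖ ≤ B := by
      by_contra hcon
      rw [not_le, hB, max_lt_iff] at hcon
      have h4 : ‖a‖ + |M| < 1 / (2 * α) * ‖v - x‖ := by
        rw [one_div, inv_mul_eq_div, lt_div_iff₀ (by positivity)]; linarith [hcon.2]
      have h5 := mul_lt_mul_of_pos_right h4 (by linarith [hcon.1] : 0 < ‖v - x‖)
      have h6 : |M| ≤ |M| * ‖v - x‖ := le_mul_of_one_le_right (abs_nonneg _) hcon.1.le
      have h7 := le_abs_self M
      nlinarith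
    refine ⟨?_, ?_, ?_⟩
    · rw [Metric.mem_closedBall, dist_comm, dist_eq_norm]; exact hxB
    · have := mul_le_mul_of_nonneg_left hxB (norm_nonneg a)
      simp only
      linarith
    · have : 0 ≤ 1 / (2 * α) * ‖v - x‖ ^ 2 := by positivity
      simp only
      linarith
  have hKc : IsCompact K :=
    ((isCompact_closedBall v B).prod isCompact_Icc).of_isClosed_subset hKcl hKsub
  obtain ⟨⟨p, t⟩, hpK, hmin⟩ := hKc.exists_isMinOn
    ⟨(x₀, r₀), hr₀.le, le_refl φ₀⟩ hφ.continuousOn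
  refine ⟨p, fun x => ?_⟩
  by_cases hx : F x = ⊤
  · rw [hx, EReal.coe_add_top]
    exact le_top
  · obtain ⟨r, hr⟩ := exists_real_of_ne (hF.1 x) hx
    have hle : φ (p, t) ≤ φ (x, r) := by
      by_cases h : φ (x, r) ≤ φ₀
      · exact hmin (show (x, r) ∈ K from ⟨hr.le, h⟩)
      · exact hpK.2.trans (not_le.1 h).le
    rw [hr]
    calc _ ≤ ((1 / (2 * α) * ‖v - p‖ ^ 2 : ℝ) : EReal) + (t : EReal) := by
          gcongr; exact hpK.1
      _ ≤ _ := by exact_mod_cast hle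

theorem IsProx.mem_subdiff (hF : IsProper F) (hconv : IsConvexFun F) {α : ℝ} (hα : 0 < α)
    {v p : E} (hp : IsProx α F v p) : α⁻¹ • (v - p) ∈ subdiff F p := by
  obtain ⟨x₀, hx₀⟩ := hF.2
  obtain ⟨r₀, hr₀⟩ := exists_real_of_ne (hF.1 x₀) hx₀
  have htop : F p ≠ ⊤ := fun h => by
    have := hp x₀
    rw [h, hr₀, EReal.coe_add_top, ← EReal.coe_add] at this
    exact EReal.coe_ne_top _ (top_le_iff.1 this)
  obtain ⟨r, hr⟩ := exists_real_of_ne (hF.1 p) htop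
  rw [mem_subdiff_iff hF.1 hr]
  intro y s hs
  -- Compare `p` with points of the segment to `y`; the quadratic error is of second order in `t`
  -- and vanishes after division.
  have key : ∀ t : ℝ, 0 < t → t ≤ 1 →
      r - s + α⁻¹ * inner ℝ (v - p) (y - p) ≤ t * (1 / (2 * α) * ‖y - p‖ ^ 2) := by
    intro t ht ht1
    have h1 : F ((1 - t) • p + t • y) ≤ (((1 - t) * r + t * s : ℝ) : EReal) :=
      hconv (show (p, r) ∈ _ from hr.le) (show (y, s) ∈ _ from hs.le)
        (by linarith : 0 ≤ 1 - t) ht.le (by ring)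
    have h2 := hp ((1 - t) • p + t • y)
    rw [hr] at h2
    have h3 : ((1 / (2 * α) * ‖v - p‖ ^ 2 : ℝ) : EReal) + (r : EReal) ≤
        ((1 / (2 * α) * ‖v - ((1 - t) • p + t • y)‖ ^ 2 : ℝ) : EReal)
          + (((1 - t) * r + t * s : ℝ) : EReal) := h2.trans (by gcongr)
    have h4 : 1 / (2 * α) * ‖v - p‖ ^ 2 + r ≤
        1 / (2 * α) * ‖v - ((1 - t) • p + t • y)‖ ^ 2 + ((1 - t) * r + t * s) := by
      exact_mod_cast h3
    have h5 : v - ((1 - t) • p + t • y) = (v - p) - t • (y - p) := by module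
    rw [h5, norm_sub_sq_real (v - p), inner_smul_right, norm_smul, Real.norm_eq_abs, mul_pow,
      sq_abs] at h4
    have h6 : t * (r - s + α⁻¹ * inner ℝ (v - p) (y - p))
        ≤ t * (t * (1 / (2 * α) * ‖y - p‖ ^ 2)) := by
      have h7 : 1 / (2 * α) * (2 * (t * inner ℝ (v - p) (y - p)))
          = t * (α⁻¹ * inner ℝ (v - p) (y - p)) := by field_simp
      simp only [mul_add, mul_sub] at h4 ⊢
      rw [h7] at h4
      linarith
    exact le_of_mul_le_mul_left h6 ht
  have hlim : Tendsto (fun t : ℝ => t * (1 / (2 * α) * ‖y - p‖ ^ 2)) (𝓝[>] 0) (𝓝 0) := by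
    have : Continuous fun t : ℝ => t * (1 / (2 * α) * ‖y - p‖ ^ 2) := by fun_prop
    have h := this.tendsto 0
    rw [zero_mul] at h
    exact h.mono_left nhdsWithin_le_nhds
  have hev : ∀ᶠ t in 𝓝[>] (0 : ℝ), r - s + α⁻¹ * inner ℝ (v - p) (y - p)
      ≤ t * (1 / (2 * α) * ‖y - p‖ ^ 2) := by
    filter_upwards [Ioc_mem_nhdsGT (zero_lt_one' ℝ)] with t ht using key t ht.1 ht.2
  have := ge_of_tendsto hlim hev
  rw [real_inner_smul_left]
  linarith

theorem IsProx.unique (hF : IsProper F) (hconv : IsConvexFun F) {α : ℝ} (hα : 0 < α)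
    {v p q : E} (hp : IsProx α F v p) (hq : IsProx α F v q) : p = q := by
  have h := subdiff_monotone hF.1 (hp.mem_subdiff hF hconv hα) (hq.mem_subdiff hF hconv hα)
  have h1 : α⁻¹ • (v - p) - α⁻¹ • (v - q) = -(α⁻¹ • (p - q)) := by module
  rw [h1, inner_neg_left, real_inner_smul_left, real_inner_self_eq_norm_sq] at h
  have h2 : 0 < α⁻¹ := inv_pos.2 hα
  have h3 : ‖p - q‖ ^ 2 ≤ 0 := by
    by_contra hcon
    have := mul_pos h2 (not_le.1 hcon)
    linarith
  have : ‖p - q‖ = 0 := by nlinarith [norm_nonneg (p - q)]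
  exact sub_eq_zero.1 (norm_eq_zero.1 this)

/-- Exhibits the epigraph of the conjugate as an intersection of closed half-spaces, whence its
closedness and convexity. -/
theorem conjugate_le_coe_iff (hF : ∀ x, F x ≠ ⊥) {y : E} {t : ℝ} :
    conjugate F y ≤ t ↔ ∀ (x : E) (r : ℝ), F x = r → inner ℝ y x - r ≤ t := by
  rw [conjugate, iSup_le_iff]
  refine forall_congr' fun x => ?_
  by_cases hx : F x = ⊤
  · simp [hx]
  · obtain ⟨s, hs⟩ := exists_real_of_ne (hF x) hx
    rw [hs]
    constructor
    · intro h r hr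
      have : s = r := by exact_mod_cast hr
      subst this
      exact_mod_cast h
    · intro h
      exact_mod_cast h s rfl

theorem isClosed_epigraph_conjugate (hF : ∀ x, F x ≠ ⊥) :
    IsClosed {p : E × ℝ | conjugate F p.1 ≤ (p.2 : EReal)} := by
  simp only [conjugate_le_coe_iff hF, Set.ofPred_forall]
  refine isClosed_iInter fun x => isClosed_iInter fun r => isClosed_iInter fun _ => ?_
  exact isClosed_le (by fun_prop) continuous_snd

theorem isConvexFun_conjugate (hF : ∀ x, F x ≠ ⊥) : IsConvexFun (conjugate F) := by
  simp only [IsConvexFun, conjugate_le_coe_iff hF]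
  rintro ⟨y, t⟩ h ⟨y', t'⟩ h' a b ha hb hab x r hr
  have h1 := h x r hr
  have h2 := h' x r hr
  simp only at h1 h2
  simp only [Prod.smul_mk, Prod.mk_add_mk, inner_add_left, real_inner_smul_left, smul_eq_mul]
  have h3 : r = a * r + b * r := by rw [← add_mul, hab, one_mul]
  have h4 := mul_le_mul_of_nonneg_left h1 ha
  have h5 := mul_le_mul_of_nonneg_left h2 hb
  linarith

theorem conjugate_ne_bot (hF : IsProper F) (y : E) : conjugate F y ≠ ⊥ := by
  obtain ⟨x, hx⟩ := hF.2
  obtain ⟨r, hr⟩ := exists_real_of_ne (hF.1 x) hx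
  have h : ((inner ℝ y x : ℝ) : EReal) - F x ≤ conjugate F y :=
    le_iSup (fun x => ((inner ℝ y x : ℝ) : EReal) - F x) x
  rw [hr, ← EReal.coe_sub] at h
  exact ne_bot_of_le_ne_bot (EReal.coe_ne_bot _) h

theorem conjugate_eq_of_mem_subdiff (hF : IsProper F) {x v : E} {r : ℝ} (hr : F x = r)
    (h : v ∈ subdiff F x) : conjugate F v = ((inner ℝ v x - r : ℝ) : EReal) := by
  refine le_antisymm ((conjugate_le_coe_iff hF.1).2 fun y s hs => ?_) ?_
  · have := (mem_subdiff_iff hF.1 hr).1 h y s hs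
    rw [inner_sub_right] at this; linarith
  · have h : ((inner ℝ v x : ℝ) : EReal) - F x ≤ conjugate F v :=
      le_iSup (fun x => ((inner ℝ v x : ℝ) : EReal) - F x) x
    rwa [hr, ← EReal.coe_sub] at h

theorem isProper_conjugate (hF : IsProper F) {x v : E} (h : v ∈ subdiff F x) :
    IsProper (conjugate F) := by
  obtain ⟨r, hr⟩ := exists_value_of_mem_subdiff h
  refine ⟨conjugate_ne_bot hF, v, ?_⟩
  rw [conjugate_eq_of_mem_subdiff hF hr h]
  exact EReal.coe_ne_top _

theorem mem_subdiff_conjugate (hF : IsProper F) {x v : E} (h : v ∈ subdiff F x) :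
    x ∈ subdiff (conjugate F) v := by
  obtain ⟨r, hr⟩ := exists_value_of_mem_subdiff h
  rw [mem_subdiff_iff (conjugate_ne_bot hF) (conjugate_eq_of_mem_subdiff hF hr h)]
  intro w s hs
  have := (conjugate_le_coe_iff hF.1).1 hs.le x r hr
  rw [inner_sub_right, real_inner_comm w x, real_inner_comm v x]
  linarith

theorem exists_isProx_of_mem_subdiff [FiniteDimensional ℝ E] (hF : IsProper F)
    (hcl : IsClosed {p : E × ℝ | F p.1 ≤ (p.2 : EReal)}) {x₀ v₀ : E}
    (h₀ : v₀ ∈ subdiff F x₀) {α : ℝ} (hα : 0 < α) (v : E) : ∃ p, IsProx α F v p := by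
  obtain ⟨r, hr⟩ := exists_value_of_mem_subdiff h₀
  refine exists_isProx hF hcl (a := v₀) (β := r - inner ℝ v₀ x₀) (fun x t hxt => ?_) hα v
  obtain ⟨s, hs⟩ := exists_real_of_ne (hF.1 x)
    (ne_top_of_le_ne_top (EReal.coe_ne_top t) hxt)
  have := (mem_subdiff_iff hF.1 hr).1 h₀ x s hs
  rw [hs] at hxt
  have hst : s ≤ t := by exact_mod_cast hxt
  rw [inner_sub_right] at this; linarith

/-- Inversion of the subdifferential of a closed convex function, by way of the proximal
point of `x + v`. -/
theorem mem_subdiff_conjugate_iff [FiniteDimensional ℝ E] (hF : IsProper F)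
    (hconv : IsConvexFun F) (hcl : IsClosed {p : E × ℝ | F p.1 ≤ (p.2 : EReal)}) {x₀ v₀ : E}
    (h₀ : v₀ ∈ subdiff F x₀) {x v : E} : x ∈ subdiff (conjugate F) v ↔ v ∈ subdiff F x := by
  refine ⟨fun h => ?_, mem_subdiff_conjugate hF⟩
  obtain ⟨p, hp⟩ := exists_isProx_of_mem_subdiff hF hcl h₀ one_pos (x + v)
  have hp' := hp.mem_subdiff hF hconv one_pos
  rw [inv_one, one_smul] at hp'
  have hmono := subdiff_monotone (conjugate_ne_bot hF) (mem_subdiff_conjugate hF hp') h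
  have h1 : x + v - p - v = -(p - x) := by abel
  rw [h1, inner_neg_right, real_inner_self_eq_norm_sq] at hmono
  have h2 : ‖p - x‖ = 0 := by nlinarith [norm_nonneg (p - x)]
  have h3 : p = x := sub_eq_zero.1 (norm_eq_zero.1 h2)
  rw [h3] at hp'
  simpa using hp'

end ConvexFunctions

/-! ### Piecewise linear-quadratic functions -/

noncomputable section PiecewiseLinearQuadratic

variable {E : Type*} [NormedAddCommGroup E] [InnerProductSpace ℝ E]

variable (E) in
/-- Finitely many cells, given by linear inequalities, with a quadratic function on each. -/
structure PLQData where
  /-- number of cells -/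
  r : ℕ
  /-- number of inequalities of each cell -/
  s : Fin r → ℕ
  /-- normals of the cells -/
  b : (i : Fin r) → Fin (s i) → E
  /-- right-hand sides of the inequalities -/
  β : (i : Fin r) → Fin (s i) → ℝ
  /-- quadratic parts -/
  P : Fin r → (E →ₗ[ℝ] E)
  /-- linear parts -/
  a : Fin r → E
  /-- constants -/
  α : Fin r → ℝ
  symm : ∀ i, (P i).IsSymmetric

namespace PLQData

variable (𝒟 : PLQData E)

/-- The `i`-th cell. -/
def cell (i : Fin 𝒟.r) : Set E := {x | ∀ j, inner ℝ (𝒟.b i j) x ≤ 𝒟.β i j}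

/-- The quadratic function on the `i`-th cell. -/
def quad (i : Fin 𝒟.r) (x : E) : ℝ :=
  (1 / 2 : ℝ) * inner ℝ x (𝒟.P i x) + inner ℝ (𝒟.a i) x + 𝒟.α i

/-- The gradient of the quadratic function on the `i`-th cell. -/
def grad (i : Fin 𝒟.r) (x : E) : E := 𝒟.P i x + 𝒟.a i

/-- The function `F` is given by the data. -/
structure Represents (F : E → EReal) : Prop where
  dom : ∀ x, F x ≠ ⊤ ↔ ∃ i, x ∈ 𝒟.cell i
  eq_quad : ∀ i, ∀ x ∈ 𝒟.cell i, F x = (𝒟.quad i x : EReal)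

/-- Nonnegative multipliers, supported on the active constraints of the `i`-th cell, that write
`ζ` as an element of the gradient plus the normal cone. -/
structure IsMultiplier (i : Fin 𝒟.r) (x ζ : E) (y : Fin (𝒟.s i) → ℝ) : Prop where
  nonneg : ∀ j, 0 ≤ y j
  compl : ∀ j, inner ℝ (𝒟.b i j) x ≠ 𝒟.β i j → y j = 0
  eq_sum : ζ = 𝒟.grad i x + ∑ j, y j • 𝒟.b i j

variable {𝒟}

theorem quad_add_smul (i : Fin 𝒟.r) (x d : E) (t : ℝ) :
    𝒟.quad i (x + t • d) = 𝒟.quad i x + t * inner ℝ (𝒟.grad i x) d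
      + t ^ 2 * (1 / 2 * inner ℝ d (𝒟.P i d)) := by
  have h : inner ℝ x (𝒟.P i d) = inner ℝ (𝒟.P i x) d := (𝒟.symm i x d).symm
  simp only [quad, grad, map_add, map_smul, inner_add_left, inner_add_right,
    real_inner_smul_left, real_inner_smul_right, h]
  rw [real_inner_comm (𝒟.P i x) d]
  ring

theorem isClosed_cell (i : Fin 𝒟.r) : IsClosed (𝒟.cell i) := by
  simp only [cell, Set.ofPred_forall]
  exact isClosed_iInter fun j => isClosed_le (by fun_prop) continuous_const

theorem convex_cell (i : Fin 𝒟.r) : Convex ℝ (𝒟.cell i) := by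
  simp only [cell, Set.ofPred_forall]
  exact convex_iInter fun j => convex_halfSpace_le (innerₗ E (𝒟.b i j)).isLinear _

theorem continuous_quad [FiniteDimensional ℝ E] (i : Fin 𝒟.r) : Continuous (𝒟.quad i) := by
  have := (𝒟.P i).continuous_of_finiteDimensional
  unfold quad
  fun_prop

theorem Represents.isClosed_epigraph [FiniteDimensional ℝ E] {F : E → EReal}
    (hR : 𝒟.Represents F) : IsClosed {p : E × ℝ | F p.1 ≤ (p.2 : EReal)} := by
  have : {p : E × ℝ | F p.1 ≤ (p.2 : EReal)}
      = ⋃ i, {p : E × ℝ | p.1 ∈ 𝒟.cell i} ∩ {p | 𝒟.quad i p.1 ≤ p.2} := by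
    ext ⟨x, t⟩
    simp only [Set.mem_ofPred_eq, Set.mem_iUnion, Set.mem_inter_iff]
    constructor
    · intro h
      obtain ⟨i, hi⟩ := (hR.dom x).1 (ne_top_of_le_ne_top (EReal.coe_ne_top t) h)
      rw [hR.eq_quad i x hi] at h
      exact ⟨i, hi, by exact_mod_cast h⟩
    · rintro ⟨i, hi, h⟩
      rw [hR.eq_quad i x hi]
      exact_mod_cast h
  rw [this]
  refine isClosed_iUnion_of_finite fun i => ?_
  exact ((isClosed_cell i).preimage continuous_fst).inter
    (isClosed_le ((continuous_quad i).comp continuous_fst) continuous_snd)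

end PLQData

theorem IsPLQ.exists_data {F : E → EReal} (h : IsPLQ F) :
    ∃ 𝒟 : PLQData E, 𝒟.Represents F := by
  obtain ⟨r, C, P, a, α, hC, hP, hdom, hF⟩ := h
  choose s b β hC using hC
  let 𝒟 : PLQData E := ⟨r, s, b, β, P, a, α, hP⟩
  have hcell : ∀ i, C i = 𝒟.cell i := hC
  refine ⟨𝒟, fun x => ?_, fun i x hx => ?_⟩
  · have : x ∈ {x | F x < ⊤} ↔ x ∈ ⋃ i, C i := by rw [hdom]
    rw [Set.mem_ofPred_eq, lt_top_iff_ne_top, Set.mem_iUnion] at this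
    simpa only [hcell] using this
  · exact hF i x (by rwa [hcell])

theorem le_of_frequently_le_add_mul {a b q : ℝ}
    (h : ∃ᶠ t in 𝓝[>] (0 : ℝ), a ≤ b + t * q) : a ≤ b := by
  by_contra hcon
  have hc : Continuous fun t : ℝ => b + t * q := by fun_prop
  have : ∀ᶠ t in 𝓝 (0 : ℝ), b + t * q < a :=
    hc.continuousAt.eventually_lt continuousAt_const (by simpa using hcon)
  obtain ⟨t, h1, h2⟩ := (h.and_eventually (nhdsWithin_le_nhds this)).exists
  linarith

namespace PLQData

variable {𝒟 : PLQData E} {F : E → EReal}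

/-- On one cell `F` is smooth, so `ζ` minus the gradient is normal to the cell, and normals are
generated by active constraints. -/
theorem Represents.exists_isMultiplier (hR : 𝒟.Represents F) (hF : ∀ x, F x ≠ ⊥) {x ζ : E}
    (h : ζ ∈ subdiff F x) {i : Fin 𝒟.r} (hi : x ∈ 𝒟.cell i) :
    ∃ y, 𝒟.IsMultiplier i x ζ y := by
  rw [mem_subdiff_iff hF (hR.eq_quad i x hi)] at h
  obtain ⟨y, hy0, hyc, hy⟩ := exists_multipliers_of_normal
    (ℓ := fun j => innerₗ E (𝒟.b i j)) (c := 𝒟.β i) (p := x) (innerₗ E (ζ - 𝒟.grad i x)) hi (by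
      intro w hw
      have key : inner ℝ ζ (w - x) ≤ inner ℝ (𝒟.grad i x) (w - x) := by
        refine le_of_frequently_le_add_mul
          (q := 1 / 2 * inner ℝ (w - x) (𝒟.P i (w - x))) (Eventually.frequently ?_)
        filter_upwards [Ioc_mem_nhdsGT (zero_lt_one' ℝ)] with t ht
        have hmem : x + t • (w - x) ∈ 𝒟.cell i := by
          have := convex_cell i hi hw (by linarith [ht.2] : 0 ≤ 1 - t) ht.1.le (by ring)
          convert this using 1
          module
        have h1 := h _ _ (hR.eq_quad i _ hmem)
        rw [add_sub_cancel_left, quad_add_smul, real_inner_smul_right] at h1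
        refine le_of_mul_le_mul_left ?_ ht.1
        linarith
      rw [innerₗ_apply_apply, inner_sub_left]
      linarith)
  refine ⟨y, hy0, hyc, ?_⟩
  rw [← sub_eq_iff_eq_add']
  refine ext_inner_right ℝ fun v => ?_
  have := congrArg (fun g : E →ₗ[ℝ] ℝ => g v) hy
  simpa [sum_inner, real_inner_smul_left, inner_sub_left] using this

/-- By convexity only the slope at `x` towards `w` matters, and it can be computed inside one cell
met by the segment arbitrarily close to `x`. -/
theorem Represents.mem_subdiff (hR : 𝒟.Represents F) (hF : ∀ x, F x ≠ ⊥)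
    (hconv : IsConvexFun F) {x ζ : E} (hx : ∃ i, x ∈ 𝒟.cell i)
    (h : ∀ i, x ∈ 𝒟.cell i → ∃ y, 𝒟.IsMultiplier i x ζ y) : ζ ∈ subdiff F x := by
  obtain ⟨r, hr⟩ := exists_real_of_ne (hF x) ((hR.dom x).2 hx)
  rw [mem_subdiff_iff hF hr]
  intro w q hq
  have hepi : ∀ t : ℝ, 0 < t → t ≤ 1 →
      F (x + t • (w - x)) ≤ (((1 - t) * r + t * q : ℝ) : EReal) := by
    intro t ht ht1
    have := hconv (show (x, r) ∈ _ from hr.le) (show (w, q) ∈ _ from hq.le)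
        (by linarith : 0 ≤ 1 - t) ht.le (by ring)
    have h1 : x + t • (w - x) = (1 - t) • x + t • w := by module
    rw [h1]
    exact this
  -- Pigeonhole: the segment lies in the domain, which finitely many cells cover.
  obtain ⟨i, hi⟩ : ∃ i, ∃ᶠ t in 𝓝[>] (0 : ℝ), x + t • (w - x) ∈ 𝒟.cell i := by
    by_contra hcon
    simp only [not_exists, not_frequently] at hcon
    rw [← eventually_all] at hcon
    obtain ⟨t, h1, h2⟩ := (hcon.and (Ioc_mem_nhdsGT (zero_lt_one' ℝ))).exists
    obtain ⟨i, hi⟩ := (hR.dom _).1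
      (ne_top_of_le_ne_top (EReal.coe_ne_top _) (hepi t h2.1 h2.2))
    exact h1 i hi
  have hxi : x ∈ 𝒟.cell i := by
    refine (isClosed_cell i).mem_of_frequently_of_tendsto hi ?_
    have : Continuous fun t : ℝ => x + t • (w - x) := by fun_prop
    have h := this.tendsto 0
    rw [zero_smul, add_zero] at h
    exact h.mono_left nhdsWithin_le_nhds
  have hrq : r = 𝒟.quad i x := by
    have := hR.eq_quad i x hxi
    rw [hr] at this
    exact_mod_cast this
  obtain ⟨y, hy⟩ := h i hxi
  have key : inner ℝ ζ (w - x) ≤ q - r := by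
    refine le_of_frequently_le_add_mul (q := -(1 / 2 * inner ℝ (w - x) (𝒟.P i (w - x))))
      ((hi.and_eventually (Ioc_mem_nhdsGT (zero_lt_one' ℝ))).mono ?_)
    rintro t ⟨hti, ht⟩
    have h1 := hepi t ht.1 ht.2
    rw [hR.eq_quad i _ hti, quad_add_smul, ← hrq] at h1
    have h2 : r + t * inner ℝ (𝒟.grad i x) (w - x)
      + t ^ 2 * (1 / 2 * inner ℝ (w - x) (𝒟.P i (w - x))) ≤ (1 - t) * r + t * q := by
      exact_mod_cast h1
    have h3 : t * inner ℝ ζ (w - x) ≤ t * inner ℝ (𝒟.grad i x) (w - x) := by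
      rw [hy.eq_sum, inner_add_left, mul_add, sum_inner, Finset.mul_sum]
      have : ∑ j, t * inner ℝ (y j • 𝒟.b i j) (w - x) ≤ 0 := by
        refine Finset.sum_nonpos fun j _ => ?_
        by_cases hj : inner ℝ (𝒟.b i j) x = 𝒟.β i j
        · have h4 := hti j
          rw [inner_add_right, real_inner_smul_right, hj] at h4
          rw [real_inner_smul_left]
          have := mul_nonpos_of_nonneg_of_nonpos (hy.nonneg j)
            (by linarith : t * inner ℝ (𝒟.b i j) (w - x) ≤ 0)
          linarith
        · rw [hy.compl j hj, zero_smul, inner_zero_left, mul_zero]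
      linarith
    refine le_of_mul_le_mul_left ?_ ht.1
    linarith
  linarith

/-! #### The graph of the subdifferential -/

variable (𝒟) in
/-- Triples of a point, a subgradient and multipliers, where the signs of the cell inequalities
are prescribed up to degeneration. -/
structure IsRelaxed (σ : (Σ i, Fin (𝒟.s i)) → SignType) (x ζ : E)
    (y : (Σ i, Fin (𝒟.s i)) → ℝ) : Prop where
  le : ∀ k, σ k ≤ 0 → inner ℝ (𝒟.b k.1 k.2) x ≤ 𝒟.β k.1 k.2
  ge : ∀ k, 0 ≤ σ k → 𝒟.β k.1 k.2 ≤ inner ℝ (𝒟.b k.1 k.2) x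
  nonneg : ∀ k, 0 ≤ y k
  compl : ∀ k, σ k ≠ 0 → y k = 0
  eq_sum : ∀ i, (∀ j, σ ⟨i, j⟩ ≤ 0) → ζ = 𝒟.grad i x + ∑ j, y ⟨i, j⟩ • 𝒟.b i j

variable (𝒟) in
/-- The sign pattern of the cell inequalities at a point. -/
def signs (x : E) (k : Σ i, Fin (𝒟.s i)) : SignType :=
  SignType.sign (inner ℝ (𝒟.b k.1 k.2) x - 𝒟.β k.1 k.2)

theorem Represents.exists_isRelaxed_signs (hR : 𝒟.Represents F) (hF : ∀ x, F x ≠ ⊥) {x ζ : E}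
    (h : ζ ∈ subdiff F x) : ∃ y, 𝒟.IsRelaxed (𝒟.signs x) x ζ y := by
  have : ∀ i, ∃ y : Fin (𝒟.s i) → ℝ, (∀ j, 0 ≤ y j) ∧
      (∀ j, inner ℝ (𝒟.b i j) x ≠ 𝒟.β i j → y j = 0) ∧
      (x ∈ 𝒟.cell i → ζ = 𝒟.grad i x + ∑ j, y j • 𝒟.b i j) := by
    intro i
    by_cases hi : x ∈ 𝒟.cell i
    · obtain ⟨y, hy⟩ := hR.exists_isMultiplier hF h hi
      exact ⟨y, hy.nonneg, hy.compl, fun _ => hy.eq_sum⟩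
    · exact ⟨0, fun _ => le_rfl, fun _ _ => rfl, fun h => absurd h hi⟩
  choose y hy0 hyc hy using this
  refine ⟨fun k => y k.1 k.2, fun k hk => ?_, fun k hk => ?_, fun k => hy0 _ _, fun k hk => ?_,
    fun i hi => hy i fun j => ?_⟩
  · simpa [signs] using hk
  · simpa [signs] using hk
  · exact hyc _ _ fun h => hk (by simp [signs, h])
  · simpa [signs] using hi j

/-- The point `x'` may lie in cells not containing `x`, about which the relaxed conditions say
nothing. Moving slightly from `x'` towards `x` leaves those cells, since the strict inequalities of
`x` become strict again; the closed graph then allows the return to `x'`. -/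
theorem Represents.mem_subdiff_of_isRelaxed [FiniteDimensional ℝ E] (hR : 𝒟.Represents F)
    (hF : IsProper F) (hconv : IsConvexFun F) {x ζ x' ζ' : E} {y y' : (Σ i, Fin (𝒟.s i)) → ℝ}
    (h : ζ ∈ subdiff F x) (hy : 𝒟.IsRelaxed (𝒟.signs x) x ζ y)
    (hy' : 𝒟.IsRelaxed (𝒟.signs x) x' ζ' y') : ζ' ∈ subdiff F x' := by
  obtain ⟨i₀, hi₀⟩ := (hR.dom x).1 h.1
  have hmem : ∀ t : ℝ, 0 < t → t ≤ 1 →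
      (1 - t) • ζ' + t • ζ ∈ subdiff F ((1 - t) • x' + t • x) := by
    intro t ht ht1
    have ht1' : 0 ≤ 1 - t := by linarith
    have hcell : ∀ i, (1 - t) • x' + t • x ∈ 𝒟.cell i → ∀ j, 𝒟.signs x ⟨i, j⟩ ≤ 0 := by
      intro i hi j
      by_contra hcon
      have h1 := hy'.ge ⟨i, j⟩ (not_le.1 hcon).le
      have h2 := hi j
      have h3 : 𝒟.β i j < inner ℝ (𝒟.b i j) x := by simpa [signs] using hcon
      simp only [inner_add_right, real_inner_smul_right] at h2
      have h4 := mul_le_mul_of_nonneg_left h1 ht1'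
      have h5 := mul_lt_mul_of_pos_left h3 ht
      simp only at h4
      linarith
    refine hR.mem_subdiff hF.1 hconv ⟨i₀, ?_⟩ fun i hi =>
      ⟨fun j => (1 - t) * y' ⟨i, j⟩ + t * y ⟨i, j⟩, fun j => ?_, fun j hj => ?_, ?_⟩
    · refine convex_cell i₀ (fun j => hy'.le ⟨i₀, j⟩ ?_) hi₀ ht1' ht.le (by ring)
      simpa [signs] using hi₀ j
    · exact add_nonneg (mul_nonneg ht1' (hy'.nonneg _)) (mul_nonneg ht.le (hy.nonneg _))
    · have hne : 𝒟.signs x ⟨i, j⟩ ≠ 0 := by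
        intro h0
        apply hj
        have h1 := le_antisymm (hy'.le _ h0.le) (hy'.ge _ h0.ge)
        have h2 := le_antisymm (hy.le _ h0.le) (hy.ge _ h0.ge)
        simp only at h1 h2
        rw [inner_add_right, real_inner_smul_right, real_inner_smul_right, h1, h2]
        ring
      rw [hy'.compl _ hne, hy.compl _ hne]
      simp
    · have h1 := hy'.eq_sum i (hcell i hi)
      have h2 := hy.eq_sum i (hcell i hi)
      simp only [add_smul, mul_smul, Finset.sum_add_distrib, ← Finset.smul_sum]
      rw [← sub_eq_iff_eq_add'] at h1 h2
      rw [← h1, ← h2]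
      simp only [grad, map_add, map_smul]
      module
  have ht : Tendsto (fun n : ℕ => (1 : ℝ) / (n + 1)) atTop (𝓝 0) :=
    tendsto_one_div_add_atTop_nhds_zero_nat
  have hlim : ∀ a b : E, Tendsto (fun n : ℕ => (1 - (1 : ℝ) / (n + 1)) • a
      + ((1 : ℝ) / (n + 1)) • b) atTop (𝓝 a) := by
    intro a b
    have := ((ht.const_sub 1).smul_const a).add (ht.smul_const b)
    simpa using this
  refine mem_subdiff_of_tendsto hF hR.isClosed_epigraph (hlim x' x) (hlim ζ' ζ)
    fun n => hmem _ (by positivity) ?_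
  rw [div_le_one (by positivity)]
  have : (0 : ℝ) ≤ n := by positivity
  linarith

/-- For a fixed sign pattern the conditions are linear in `(x, ζ, y)` jointly, so Hoffman's bound
applies; the multipliers are auxiliary and their estimate is dropped. -/
theorem exists_isRelaxed_near [FiniteDimensional ℝ E] {Y : Type*} [NormedAddCommGroup Y]
    [NormedSpace ℝ Y] [FiniteDimensional ℝ Y] (Φ : E × E →ₗ[ℝ] Y) (d : Y)
    (σ : (Σ i, Fin (𝒟.s i)) → SignType) :
    ∃ ε C : ℝ, 0 < ε ∧ 0 ≤ C ∧ ∀ x ζ y, 𝒟.IsRelaxed σ x ζ y → ‖Φ (x, ζ) - d‖ < ε →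
      ∃ x' ζ' y', 𝒟.IsRelaxed σ x' ζ' y' ∧ Φ (x', ζ') = d ∧
        ‖x - x'‖ ≤ C * ‖Φ (x, ζ) - d‖ ∧ ‖ζ - ζ'‖ ≤ C * ‖Φ (x, ζ) - d‖ := by
  classical
  let κ := Σ i, Fin (𝒟.s i)
  let V := E × E × (κ → ℝ)
  let X : V →ₗ[ℝ] E := LinearMap.fst ℝ E (E × (κ → ℝ))
  let Z : V →ₗ[ℝ] E := (LinearMap.fst ℝ E (κ → ℝ)).comp (LinearMap.snd ℝ E (E × (κ → ℝ)))
  let Λ : κ → V →ₗ[ℝ] ℝ := fun k => (LinearMap.proj k).comp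
    ((LinearMap.snd ℝ E (κ → ℝ)).comp (LinearMap.snd ℝ E (E × (κ → ℝ))))
  let ℓ : ({k : κ // σ k ≤ 0} ⊕ {k : κ // 0 ≤ σ k}) ⊕ (κ ⊕ {k : κ // σ k ≠ 0}) → V →ₗ[ℝ] ℝ :=
    Sum.elim
      (Sum.elim (fun k => (innerₗ E (𝒟.b k.1.1 k.1.2)).comp X)
        (fun k => -(innerₗ E (𝒟.b k.1.1 k.1.2)).comp X))
      (Sum.elim (fun k => -Λ k) (fun k => Λ k.1))
  let c : ({k : κ // σ k ≤ 0} ⊕ {k : κ // 0 ≤ σ k}) ⊕ (κ ⊕ {k : κ // σ k ≠ 0}) → ℝ :=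
    Sum.elim (Sum.elim (fun k => 𝒟.β k.1.1 k.1.2) (fun k => -𝒟.β k.1.1 k.1.2))
      (Sum.elim (fun _ => 0) (fun _ => 0))
  let Ψ : V →ₗ[ℝ] (Fin 𝒟.r → E) := LinearMap.pi fun i =>
    if ∀ j, σ ⟨i, j⟩ ≤ 0 then
      Z - (𝒟.P i).comp X - ∑ j, (Λ ⟨i, j⟩).smulRight (𝒟.b i j) else 0
  let a : Fin 𝒟.r → E := fun i => if ∀ j, σ ⟨i, j⟩ ≤ 0 then 𝒟.a i else 0
  have hiff : ∀ x ζ y, 𝒟.IsRelaxed σ x ζ y ↔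
      (∀ k, ℓ k (x, ζ, y) ≤ c k) ∧ Ψ (x, ζ, y) = a := by
    intro x ζ y
    have hΨ : Ψ (x, ζ, y) = a ↔
        ∀ i, (∀ j, σ ⟨i, j⟩ ≤ 0) → ζ = 𝒟.grad i x + ∑ j, y ⟨i, j⟩ • 𝒟.b i j := by
      rw [funext_iff]
      refine forall_congr' fun i => ?_
      by_cases hi : ∀ j, σ ⟨i, j⟩ ≤ 0
      · have e : ∀ p : Prop, ((∀ j, σ ⟨i, j⟩ ≤ 0) → p) ↔ p := fun p =>
          ⟨fun h => h hi, fun h _ => h⟩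
        simp only [Ψ, a, LinearMap.pi_apply]
        rw [if_pos hi, if_pos hi, e]
        simp only [X, Z, Λ, LinearMap.sub_apply, LinearMap.comp_apply, LinearMap.fst_apply,
          LinearMap.snd_apply, LinearMap.sum_apply, LinearMap.smulRight_apply,
          LinearMap.proj_apply, grad]
        rw [sub_eq_iff_eq_add, sub_eq_iff_eq_add]
        have h : 𝒟.P i x + 𝒟.a i + ∑ j, y ⟨i, j⟩ • 𝒟.b i j
            = 𝒟.a i + ∑ j, y ⟨i, j⟩ • 𝒟.b i j + 𝒟.P i x := by abel
        rw [h]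
        exact Iff.rfl
      · simp [Ψ, a, hi]
    rw [hΨ]
    simp only [Sum.forall, Subtype.forall, ℓ, c, Sum.elim_inl, Sum.elim_inr, X, Λ,
      LinearMap.comp_apply, LinearMap.neg_apply, LinearMap.snd_apply,
      LinearMap.proj_apply, innerₗ_apply_apply, neg_le_neg_iff, neg_nonpos]
    constructor
    · rintro ⟨h1, h2, h3, h4, h5⟩
      exact ⟨⟨⟨h1, h2⟩, h3, fun k hk => (h4 k hk).le⟩, h5⟩
    · rintro ⟨⟨⟨h1, h2⟩, h3, h4⟩, h5⟩
      exact ⟨h1, h2, h3, fun k hk => le_antisymm (h4 k hk) (h3 k), h5⟩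
  obtain ⟨ε, C, hε, hC0, hC⟩ := hoffman_with_equation ℓ c (Ψ.prod (Φ.comp (X.prod Z))) (a, d)
  refine ⟨ε, C, hε, hC0, fun x ζ y h hd => ?_⟩
  obtain ⟨h1, h2⟩ := (hiff x ζ y).1 h
  -- The structural equations hold exactly at the given triple, so only `Φ` contributes to the
  -- residual.
  have hres : ‖(Ψ.prod (Φ.comp (X.prod Z))) (x, ζ, y) - (a, d)‖ = ‖Φ (x, ζ) - d‖ := by
    have : (Ψ.prod (Φ.comp (X.prod Z))) (x, ζ, y) - (a, d) = (0, Φ (x, ζ) - d) := by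
      simp only [LinearMap.prod_apply, Function.prod_apply, h2, Prod.mk_sub_mk, sub_self]
      rfl
    rw [this, Prod.norm_def, norm_zero]
    exact max_eq_right (norm_nonneg _)
  rw [← hres] at hd
  obtain ⟨⟨x', ζ', y'⟩, h1', h2', h3'⟩ := hC _ h1 hd
  rw [hres] at h3'
  have h4 : Ψ (x', ζ', y') = a := congrArg Prod.fst h2'
  have h5 : Φ (x', ζ') = d := congrArg Prod.snd h2'
  refine ⟨x', ζ', y', (hiff _ _ _).2 ⟨h1', h4⟩, h5, ?_, ?_⟩
  · exact (norm_fst_le ((x, ζ, y) - (x', ζ', y'))).trans h3'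
  · exact ((norm_fst_le ((x, ζ, y) - (x', ζ', y')).2).trans (norm_snd_le _)).trans h3'

/-- The subdifferential of a convex piecewise linear-quadratic function is a polyhedral
multifunction: a linear equation on its graph has a local error bound. -/
theorem Represents.exists_error_bound [FiniteDimensional ℝ E] {Y : Type*}
    [NormedAddCommGroup Y] [NormedSpace ℝ Y] [FiniteDimensional ℝ Y] (hR : 𝒟.Represents F)
    (hF : IsProper F) (hconv : IsConvexFun F) (Φ : E × E →ₗ[ℝ] Y) (d : Y) :
    ∃ ε C : ℝ, 0 < ε ∧ 0 ≤ C ∧ ∀ x ζ, ζ ∈ subdiff F x → ‖Φ (x, ζ) - d‖ < ε →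
      ∃ x' ζ', ζ' ∈ subdiff F x' ∧ Φ (x', ζ') = d ∧
        ‖x - x'‖ ≤ C * ‖Φ (x, ζ) - d‖ ∧ ‖ζ - ζ'‖ ≤ C * ‖Φ (x, ζ) - d‖ := by
  choose ε C hε hC0 hC using exists_isRelaxed_near (𝒟 := 𝒟) Φ d
  obtain ⟨σ₀, hσ₀⟩ := Finite.exists_min ε
  obtain ⟨σ₁, hσ₁⟩ := Finite.exists_max C
  refine ⟨ε σ₀, C σ₁, hε _, hC0 _, fun x ζ h hd => ?_⟩
  obtain ⟨y, hy⟩ := hR.exists_isRelaxed_signs hF.1 h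
  obtain ⟨x', ζ', y', hy', hΦ, h1, h2⟩ := hC _ x ζ y hy (hd.trans_le (hσ₀ _))
  have hle := mul_le_mul_of_nonneg_right (hσ₁ (𝒟.signs x)) (norm_nonneg (Φ (x, ζ) - d))
  exact ⟨x', ζ', hR.mem_subdiff_of_isRelaxed hF hconv h hy hy', hΦ, h1.trans hle, h2.trans hle⟩

end PLQData

end PiecewiseLinearQuadratic

/-! ### Dual attainment via Farkas' lemma -/

/-- Translates `c i + K i` of finitely generated cones have a common point in `Uᗮ`, if the
corresponding dual condition holds. -/
theorem exists_common_translate {E : Type*} [NormedAddCommGroup E] [InnerProductSpace ℝ E]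
    [FiniteDimensional ℝ E] (U : Submodule ℝ E) {I : Type*} [Fintype I] {J : I → Type*}
    [∀ i, Fintype (J i)] (b : (i : I) → J i → E) (p : (i : I) → J i → Prop) (c : I → E)
    (h : ∀ d : I → E, (∀ i j, p i j → inner ℝ (b i j) (d i) ≤ 0) → ∑ i, d i ∈ U →
      0 ≤ ∑ i, inner ℝ (c i) (d i)) :
    ∃ w ∈ Uᗮ, ∃ y : (i : I) → J i → ℝ, (∀ i j, 0 ≤ y i j) ∧ (∀ i j, ¬ p i j → y i j = 0) ∧
      ∀ i, w = c i + ∑ j, y i j • b i j := by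
  classical
  let e := stdOrthonormalBasis ℝ Uᗮ
  let sumMap : (I → E) →ₗ[ℝ] E := ∑ i : I, LinearMap.proj i
  have hsumMap : ∀ d, sumMap d = ∑ i, d i := fun d => by simp [sumMap]
  -- The condition `∑ i, d i ∈ U` is encoded by opposite inequalities along a basis of `Uᗮ`; their
  -- multipliers assemble into `w`.
  let ℓ : (Σ i, J i) ⊕ (Fin (Module.finrank ℝ Uᗮ) ⊕ Fin (Module.finrank ℝ Uᗮ)) →
      (I → E) →ₗ[ℝ] ℝ :=
    Sum.elim (fun k => if p k.1 k.2 then (innerₗ E (b k.1 k.2)).comp (LinearMap.proj k.1) else 0)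
      (Sum.elim (fun m => (innerₗ E (e m : E)).comp sumMap)
        (fun m => -(innerₗ E (e m : E)).comp sumMap))
  have hℓ1 : ∀ k d, ℓ (Sum.inl k) d
      = if p k.1 k.2 then inner ℝ (b k.1 k.2) (d k.1) else 0 := fun k d => by
    simp only [ℓ, Sum.elim_inl]
    split_ifs <;> simp
  have hℓ2 : ∀ m d, ℓ (Sum.inr (Sum.inl m)) d = inner ℝ (e m : E) (∑ i, d i) := fun m d => by
    simp [ℓ, hsumMap, inner_sum]
  have hℓ3 : ∀ m d, ℓ (Sum.inr (Sum.inr m)) d = -inner ℝ (e m : E) (∑ i, d i) := fun m d => by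
    simp [ℓ, hsumMap, inner_sum]
  let B : (I → E) →ₗ[ℝ] ℝ := -∑ i : I, (innerₗ E (c i)).comp (LinearMap.proj i)
  have hBd : ∀ d, B d = -∑ i, inner ℝ (c i) (d i) := fun d => by simp [B]
  obtain ⟨y, hy0, hB⟩ := exists_nonneg_combination ℓ B (by
    intro d hd
    have h1 : ∀ i j, p i j → inner ℝ (b i j) (d i) ≤ 0 := by
      intro i j hj
      have := hd (Sum.inl ⟨i, j⟩)
      rwa [hℓ1, if_pos hj] at this
    have h2 : ∀ m, inner ℝ (e m : E) (∑ i, d i) = 0 := by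
      intro m
      have ha := hd (Sum.inr (Sum.inl m))
      have hb := hd (Sum.inr (Sum.inr m))
      rw [hℓ2] at ha
      rw [hℓ3] at hb
      linarith
    have h3 : ∑ i, d i ∈ U := by
      rw [← U.orthogonal_orthogonal, Submodule.mem_orthogonal]
      intro u hu
      have h5 : u = ∑ m, e.repr ⟨u, hu⟩ m • (e m : E) := by
        have := congrArg (fun v : Uᗮ => (v : E)) (e.sum_repr ⟨u, hu⟩)
        simpa using this.symm
      rw [h5, sum_inner]
      exact Finset.sum_eq_zero fun m _ => by rw [real_inner_smul_left, h2, mul_zero]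
    have := h d h1 h3
    rw [hBd]
    linarith)
  let w : E := -∑ m, (y (Sum.inr (Sum.inl m)) - y (Sum.inr (Sum.inr m))) • (e m : E)
  refine ⟨w, Uᗮ.neg_mem (Submodule.sum_mem _ fun m _ => Uᗮ.smul_mem _ (e m).2),
    fun i j => if p i j then y (Sum.inl ⟨i, j⟩) else 0, fun i j => ?_, fun i j hj => if_neg hj,
    fun i => ?_⟩
  · dsimp only
    split_ifs
    · exact hy0 _
    · exact le_rfl
  · refine ext_inner_right ℝ fun v => ?_
    have h1 := congrArg (fun g : (I → E) →ₗ[ℝ] ℝ => g (Pi.single i v)) hB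
    have hs : ∑ k, (Pi.single i v : I → E) k = v := by
      rw [Finset.sum_eq_single i (fun k _ hk => by simp [hk]) (by simp)]
      simp
    have hBv : B (Pi.single i v) = -inner ℝ (c i) v := by
      rw [hBd, Finset.sum_eq_single i (fun k _ hk => by simp [hk]) (by simp)]
      simp
    simp only [LinearMap.sum_apply, LinearMap.smul_apply] at h1
    simp only [Fintype.sum_sum_type, hBv, hℓ1, hℓ2,
      hℓ3, hs, smul_eq_mul] at h1
    rw [Fintype.sum_sigma, Finset.sum_eq_single i (fun k _ hk => Finset.sum_eq_zero fun j _ => by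
      simp [hk]) (by simp)] at h1
    have h2 : inner ℝ w v = -(∑ m, y (Sum.inr (Sum.inl m)) * inner ℝ (e m : E) v
        + ∑ m, y (Sum.inr (Sum.inr m)) * -inner ℝ (e m : E) v) := by
      simp only [w]
      rw [inner_neg_left, sum_inner, ← Finset.sum_add_distrib]
      congr 1
      refine Finset.sum_congr rfl fun m _ => ?_
      rw [real_inner_smul_left]; ring
    have h3 : inner ℝ (∑ j, (if p i j then y (Sum.inl ⟨i, j⟩) else 0) • b i j) v
        = ∑ j, y (Sum.inl ⟨i, j⟩) *
          if p i j then inner ℝ (b i j) ((Pi.single i v : I → E) i) else 0 := by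
      rw [sum_inner]
      refine Finset.sum_congr rfl fun j _ => ?_
      split_ifs <;> simp [real_inner_smul_left]
    rw [inner_add_left, h2, h3]
    linarith

namespace PLQData

variable {E : Type*} [NormedAddCommGroup E] [InnerProductSpace ℝ E] {𝒟 : PLQData E}
  {F : E → EReal}

/-- First-order condition for a minimizer on the affine subspace `x + U`: along directions into
the cells at `x` that add up to an element of `U`, the gradients add up to a nonnegative slope. -/
theorem Represents.sum_grad_nonneg (hR : 𝒟.Represents F) (hF : ∀ x, F x ≠ ⊥)
    (hconv : IsConvexFun F) (U : Submodule ℝ E) {x : E} (hx : F x ≠ ⊤)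
    (hmin : ∀ d ∈ U, F x ≤ F (x + d)) [Fintype {i // x ∈ 𝒟.cell i}]
    (d : {i // x ∈ 𝒟.cell i} → E)
    (hd : ∀ i j, inner ℝ (𝒟.b i.1 j) x = 𝒟.β i.1 j → inner ℝ (𝒟.b i.1 j) (d i) ≤ 0)
    (hU : ∑ i, d i ∈ U) : 0 ≤ ∑ i, inner ℝ (𝒟.grad i.1 x) (d i) := by
  classical
  obtain ⟨r, hr⟩ := exists_real_of_ne (hF x) hx
  obtain ⟨i₀, hi₀⟩ := (hR.dom x).1 hx
  set n : ℝ := (Fintype.card {i // x ∈ 𝒟.cell i} : ℝ) with hn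
  have hn0 : 0 < n := by
    have : 0 < Fintype.card {i // x ∈ 𝒟.cell i} := Fintype.card_pos_iff.2 ⟨⟨i₀, hi₀⟩⟩
    rw [hn]
    exact_mod_cast this
  have hev : ∀ᶠ t in 𝓝[>] (0 : ℝ), ∀ i : {i // x ∈ 𝒟.cell i}, x + t • d i ∈ 𝒟.cell i.1 := by
    rw [eventually_all]
    intro i
    exact eventually_feasible_direction (ℓ := fun j => innerₗ E (𝒟.b i.1 j)) (c := 𝒟.β i.1)
      i.2 fun j hj => hd i j hj
  refine le_of_frequently_le_add_mul
    (q := ∑ i, 1 / 2 * inner ℝ (d i) (𝒟.P i.1 (d i))) (Eventually.frequently ?_)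
  filter_upwards [hev, self_mem_nhdsWithin] with t ht ht0
  have ht0 : 0 < t := ht0
  let q : {i // x ∈ 𝒟.cell i} → ℝ := fun i => r + t * inner ℝ (𝒟.grad i.1 x) (d i)
      + t ^ 2 * (1 / 2 * inner ℝ (d i) (𝒟.P i.1 (d i)))
  have hmem : ∀ i ∈ Finset.univ, (x + t • d i, q i) ∈ {p : E × ℝ | F p.1 ≤ (p.2 : EReal)} := by
    intro i _
    have h1 := hR.eq_quad i.1 x i.2
    rw [hr] at h1
    have h2 : r = 𝒟.quad i.1 x := by exact_mod_cast h1
    show F (x + t • d i) ≤ (q i : EReal)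
    rw [hR.eq_quad i.1 _ (ht i), quad_add_smul, ← h2]
  -- Single directions `d i` need not lie in `U`, but the average of the points `x + t • d i` is
  -- displaced from `x` by an element of `U`, so minimality applies there.
  have hsum := hconv.sum_mem (w := fun _ => n⁻¹) (fun _ _ => by positivity)
    (by simp [← hn, hn0.ne']) hmem
  have hfst : (∑ i, n⁻¹ • ((x + t • d i, q i) : E × ℝ)).1 = x + (n⁻¹ * t) • ∑ i, d i := by
    rw [← Finset.smul_sum, Prod.smul_fst, Prod.fst_sum]
    simp only [Finset.sum_add_distrib, ← Finset.smul_sum, Finset.sum_const, Finset.card_univ,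
      smul_add, smul_smul]
    rw [← Nat.cast_smul_eq_nsmul ℝ, ← hn, smul_smul, inv_mul_cancel₀ hn0.ne', one_smul]
  have hsnd : (∑ i, n⁻¹ • ((x + t • d i, q i) : E × ℝ)).2 = r + n⁻¹ * t *
      (∑ i, inner ℝ (𝒟.grad i.1 x) (d i)
        + t * ∑ i, 1 / 2 * inner ℝ (d i) (𝒟.P i.1 (d i))) := by
    rw [← Finset.smul_sum, Prod.smul_snd, Prod.snd_sum]
    simp only [q, Finset.sum_add_distrib, ← Finset.mul_sum, Finset.sum_const, Finset.card_univ,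
      nsmul_eq_mul, smul_eq_mul]
    rw [← hn]
    field_simp
    ring
  have hle : F (x + (n⁻¹ * t) • ∑ i, d i)
      ≤ (((∑ i, n⁻¹ • ((x + t • d i, q i) : E × ℝ)).2 : ℝ) : EReal) := by
    rw [← hfst]; exact hsum
  rw [hsnd] at hle
  have h1 := (hmin _ (U.smul_mem (n⁻¹ * t) hU)).trans hle
  rw [hr] at h1
  have h2 := EReal.coe_le_coe_iff.1 h1
  have h3 : 0 < n⁻¹ * t := by positivity
  by_contra hcon
  have := mul_neg_of_pos_of_neg h3 (not_le.1 hcon)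
  linarith

/-- Dual attainment: no constraint qualification is needed for piecewise linear-quadratic
functions and linear constraints. -/
theorem Represents.exists_orthogonal_subgradient [FiniteDimensional ℝ E]
    (hR : 𝒟.Represents F) (hF : ∀ x, F x ≠ ⊥) (hconv : IsConvexFun F) (U : Submodule ℝ E)
    {x : E} (hx : F x ≠ ⊤) (hmin : ∀ d ∈ U, F x ≤ F (x + d)) :
    ∃ ζ ∈ subdiff F x, ζ ∈ Uᗮ := by
  classical
  obtain ⟨w, hw, y, hy0, hyc, hy⟩ := exists_common_translate U
    (fun (i : {i // x ∈ 𝒟.cell i}) (j : Fin (𝒟.s i.1)) => 𝒟.b i.1 j)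
    (fun i j => inner ℝ (𝒟.b i.1 j) x = 𝒟.β i.1 j) (fun i => 𝒟.grad i.1 x)
    fun d hd hU => hR.sum_grad_nonneg hF hconv U hx hmin d hd hU
  exact ⟨w, hR.mem_subdiff hF hconv ((hR.dom x).1 hx) fun i hi =>
    ⟨y ⟨i, hi⟩, hy0 ⟨i, hi⟩, hyc ⟨i, hi⟩, hy ⟨i, hi⟩⟩, hw⟩

end PLQData

/-! ### Fejér monotone sequences with an error bound -/

section Fejer

variable {V : Type*} [NormedAddCommGroup V] {S : Set V} {ξ : ℕ → V}

theorem fejer_antitone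
    (hfej : ∀ k, ∀ p ∈ S, ‖ξ (k + 1) - p‖ ^ 2 + ‖ξ k - ξ (k + 1)‖ ^ 2 ≤ ‖ξ k - p‖ ^ 2)
    {p : V} (hp : p ∈ S) : Antitone fun k => ‖ξ k - p‖ := by
  refine antitone_nat_of_succ_le fun k => ?_
  have := hfej k p hp
  refine (sq_le_sq₀ (norm_nonneg _) (norm_nonneg _)).1 ?_
  nlinarith [sq_nonneg ‖ξ k - ξ (k + 1)‖]

theorem fejer_step_tendsto_zero
    (hfej : ∀ k, ∀ p ∈ S, ‖ξ (k + 1) - p‖ ^ 2 + ‖ξ k - ξ (k + 1)‖ ^ 2 ≤ ‖ξ k - p‖ ^ 2)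
    {p : V} (hp : p ∈ S) : Tendsto (fun k => ‖ξ k - ξ (k + 1)‖) atTop (𝓝 0) := by
  have hlim := tendsto_atTop_ciInf (fejer_antitone hfej hp)
    ⟨0, by rintro _ ⟨k, rfl⟩; exact norm_nonneg _⟩
  have h1 := (hlim.pow 2).sub ((hlim.comp (tendsto_add_atTop_nat 1)).pow 2)
  rw [sub_self] at h1
  have h2 : Tendsto (fun k => ‖ξ k - ξ (k + 1)‖ ^ 2) atTop (𝓝 0) :=
    squeeze_zero (fun k => sq_nonneg _) (fun k => by
      have := hfej k p hp
      simp only [Function.comp]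
      linarith) h1
  have h3 := h2.sqrt
  simpa [Real.sqrt_sq (norm_nonneg _)] using h3

/-- A Fejér monotone sequence whose steps bound the distance to the target set converges to
a point of the set, and contracts towards that point. -/
theorem fejer_linear_convergence [CompleteSpace V] (hS : IsClosed S) (hne : S.Nonempty)
    (hfej : ∀ k, ∀ p ∈ S, ‖ξ (k + 1) - p‖ ^ 2 + ‖ξ k - ξ (k + 1)‖ ^ 2 ≤ ‖ξ k - p‖ ^ 2)
    {ε C : ℝ} (hε : 0 < ε) (hC : 1 ≤ C)
    (herr : ∀ k, ‖ξ k - ξ (k + 1)‖ < ε → ∃ p ∈ S, ‖ξ k - p‖ ≤ C * ‖ξ k - ξ (k + 1)‖) :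
    ∃ ξs ∈ S, Tendsto ξ atTop (𝓝 ξs) ∧ ∀ k, ‖ξ k - ξs‖ < ε →
      ‖ξ (k + 1) - ξs‖ ≤ Real.sqrt (1 - 1 / (4 * C ^ 2)) * ‖ξ k - ξs‖ := by
  obtain ⟨p₀, hp₀⟩ := hne
  have hstep := fejer_step_tendsto_zero hfej hp₀
  -- All later iterates stay as close to the nearby point `p` of `S` as `ξ k` is, so a short step
  -- confines the whole tail.
  have key : ∀ k, ‖ξ k - ξ (k + 1)‖ < ε → ∀ n, k ≤ n →
      ‖ξ n - ξ k‖ ≤ 2 * C * ‖ξ k - ξ (k + 1)‖ := by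
    intro k hk n hn
    obtain ⟨p, hp, hpk⟩ := herr k hk
    have h1 : ‖ξ n - p‖ ≤ ‖ξ k - p‖ := fejer_antitone hfej hp hn
    have h2 := norm_sub_le_norm_sub_add_norm_sub (ξ n) p (ξ k)
    rw [norm_sub_rev p] at h2
    linarith
  have hsmall : ∀ δ > 0, ∃ k, ‖ξ k - ξ (k + 1)‖ < ε ∧ 3 * C * ‖ξ k - ξ (k + 1)‖ < δ := by
    intro δ hδ
    have h1 := hstep.eventually_lt_const hε
    have h2 := (hstep.const_mul (3 * C)).eventually_lt_const (show 3 * C * 0 < δ by simpa)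
    exact (h1.and h2).exists
  have hcauchy : CauchySeq ξ := by
    rw [Metric.cauchySeq_iff']
    intro δ hδ
    obtain ⟨k, hk, hkδ⟩ := hsmall δ hδ
    refine ⟨k, fun n hn => ?_⟩
    rw [dist_eq_norm]
    have h1 := key k hk n hn
    have h2 : 0 ≤ C * ‖ξ k - ξ (k + 1)‖ := by positivity
    linarith
  obtain ⟨ξs, hlim⟩ := cauchySeq_tendsto_of_complete hcauchy
  have hlimk : ∀ k, ‖ξ k - ξ (k + 1)‖ < ε → ‖ξ k - ξs‖ ≤ 2 * C * ‖ξ k - ξ (k + 1)‖ := by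
    intro k hk
    rw [norm_sub_rev]
    refine le_of_tendsto (hlim.sub_const (ξ k)).norm ?_
    filter_upwards [eventually_ge_atTop k] with n hn using key k hk n hn
  have hmem : ξs ∈ S := by
    rw [← hS.closure_eq, Metric.mem_closure_iff]
    intro δ hδ
    obtain ⟨k, hk, hkδ⟩ := hsmall δ hδ
    obtain ⟨p, hp, hpk⟩ := herr k hk
    refine ⟨p, hp, ?_⟩
    rw [dist_eq_norm]
    have h2 := norm_sub_le_norm_sub_add_norm_sub ξs (ξ k) p
    rw [norm_sub_rev ξs (ξ k)] at h2
    have := hlimk k hk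
    linarith
  refine ⟨ξs, hmem, hlim, fun k hk => ?_⟩
  have hf := hfej k ξs hmem
  have hs0 := norm_nonneg (ξ k - ξ (k + 1))
  have hb0 := norm_nonneg (ξ k - ξs)
  have hs : ‖ξ k - ξ (k + 1)‖ ≤ ‖ξ k - ξs‖ := by
    refine (sq_le_sq₀ hs0 hb0).1 ?_
    nlinarith [sq_nonneg ‖ξ (k + 1) - ξs‖]
  have hb := hlimk k (hs.trans_lt hk)
  have hC0 : 0 < 4 * C ^ 2 := by positivity
  -- The Fejér gain is thus a fixed fraction `1 / (4 * C ^ 2)` of the squared distance to the limit.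
  have hq : ‖ξ k - ξs‖ ^ 2 ≤ 4 * C ^ 2 * ‖ξ k - ξ (k + 1)‖ ^ 2 := by
    have := (sq_le_sq₀ hb0 (by positivity)).2 hb
    nlinarith
  rw [← div_le_iff₀' hC0] at hq
  have hκ : 0 ≤ 1 - 1 / (4 * C ^ 2) := by
    rw [sub_nonneg, div_le_one hC0]; nlinarith
  refine (sq_le_sq₀ (norm_nonneg _) (by positivity)).1 ?_
  rw [mul_pow, Real.sq_sqrt hκ, sub_mul, one_mul, one_div_mul_eq_div]
  linarith

end Fejer

/-! ### Indicator functions of affine subspaces -/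

noncomputable section AffineIndicator

variable {E : Type*} [NormedAddCommGroup E] [InnerProductSpace ℝ E] {Y : Type*}
  [NormedAddCommGroup Y] [NormedSpace ℝ Y]

open Classical in
/-- The indicator function of the affine subspace `L z = w`. -/
def affineIndicator (L : E →ₗ[ℝ] Y) (w : Y) (z : E) : EReal :=
  if L z = w then 0 else ⊤

variable {L : E →ₗ[ℝ] Y} {w : Y}

theorem affineIndicator_eq_coe_iff {z : E} {s : ℝ} :
    affineIndicator L w z = s ↔ L z = w ∧ s = 0 := by
  unfold affineIndicator
  split_ifs with h
  · simp only [h, true_and]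
    rw [eq_comm]
    exact EReal.coe_eq_zero
  · simp [h]

theorem affineIndicator_le_coe_iff {z : E} {t : ℝ} :
    affineIndicator L w z ≤ t ↔ L z = w ∧ 0 ≤ t := by
  unfold affineIndicator
  split_ifs with h
  · simp [h]
  · simp [h]

theorem affineIndicator_ne_bot (z : E) : affineIndicator L w z ≠ ⊥ := by
  unfold affineIndicator
  split_ifs <;> simp

theorem isProper_affineIndicator {z₀ : E} (h : L z₀ = w) : IsProper (affineIndicator L w) :=
  ⟨affineIndicator_ne_bot, z₀, by simp [affineIndicator, h]⟩

theorem isConvexFun_affineIndicator : IsConvexFun (affineIndicator L w) := by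
  simp only [IsConvexFun, affineIndicator_le_coe_iff]
  rintro ⟨x, s⟩ ⟨hx, hs⟩ ⟨y, t⟩ ⟨hy, ht⟩ a b ha hb hab
  simp only at hx hs hy ht
  refine ⟨?_, ?_⟩
  · simp only [Prod.smul_mk, Prod.mk_add_mk, map_add, map_smul, hx, hy]
    rw [← add_smul, hab, one_smul]
  · simp only [Prod.smul_mk, Prod.mk_add_mk, smul_eq_mul]
    positivity

theorem isClosed_epigraph_affineIndicator [FiniteDimensional ℝ E] :
    IsClosed {p : E × ℝ | affineIndicator L w p.1 ≤ (p.2 : EReal)} := by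
  simp only [affineIndicator_le_coe_iff]
  have := L.continuous_of_finiteDimensional
  exact (isClosed_eq (this.comp continuous_fst) continuous_const).inter
    (isClosed_le continuous_const continuous_snd)

theorem mem_subdiff_affineIndicator {z v : E} :
    v ∈ subdiff (affineIndicator L w) z ↔ L z = w ∧ v ∈ (LinearMap.ker L)ᗮ := by
  constructor
  · intro h
    obtain ⟨r, hr⟩ := exists_value_of_mem_subdiff h
    have hz := (affineIndicator_eq_coe_iff.1 hr).1
    refine ⟨hz, (Submodule.mem_orthogonal' _ _).2 fun u hu => ?_⟩
    rw [mem_subdiff_iff affineIndicator_ne_bot hr] at h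
    have h0 := (affineIndicator_eq_coe_iff.1 hr).2
    have key : ∀ u ∈ LinearMap.ker L, inner ℝ v u ≤ 0 := by
      intro u hu
      have := h (z + u) 0 (affineIndicator_eq_coe_iff.2
        ⟨by rw [map_add, LinearMap.mem_ker.1 hu, add_zero, hz], rfl⟩)
      rw [add_sub_cancel_left] at this
      linarith
    have h1 := key u hu
    have h2 := key (-u) (Submodule.neg_mem _ hu)
    rw [inner_neg_right] at h2
    linarith
  · rintro ⟨hz, hv⟩
    have hr : affineIndicator L w z = ((0 : ℝ) : EReal) :=
      affineIndicator_eq_coe_iff.2 ⟨hz, rfl⟩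
    rw [mem_subdiff_iff affineIndicator_ne_bot hr]
    intro y s hs
    obtain ⟨hy, rfl⟩ := affineIndicator_eq_coe_iff.1 hs
    rw [(Submodule.mem_orthogonal' _ _).1 hv (y - z) (by
      rw [LinearMap.mem_ker, map_sub, hy, hz, sub_self]), add_zero]

end AffineIndicator

/-! ### The splitting iteration -/

noncomputable section Iteration

variable {E : Type*} [NormedAddCommGroup E] [InnerProductSpace ℝ E] {g ρ : E → EReal} {τ σ : ℝ}

theorem primalDual_ext {E : Type*} {x y : PrimalDual E} (h₁ : x.fst = y.fst)
    (h₂ : x.snd = y.snd) : x = y :=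
  WithLp.ofLp_injective 2 (Prod.ext h₁ h₂)

theorem isPrimalDualSolution_iff {η : PrimalDual E} : IsPrimalDualSolution g ρ η ↔
    -η.snd ∈ subdiff g η.fst ∧ η.fst ∈ subdiff (conjugate ρ) η.snd := by
  constructor
  · rintro ⟨v, ⟨h1, h2⟩, hv⟩
    have hv1 : v.fst + η.snd = 0 := congrArg WithLp.fst hv
    have hv2 : v.snd + -η.fst = 0 := congrArg WithLp.snd hv
    rw [← eq_neg_of_add_eq_zero_left hv1]
    rw [add_neg_eq_zero] at hv2
    rw [hv2] at h2
    exact ⟨h1, h2⟩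
  · rintro ⟨h1, h2⟩
    exact ⟨WithLp.toLp 2 (-η.snd, η.fst), ⟨h1, h2⟩,
      primalDual_ext (neg_add_cancel η.snd) (add_neg_cancel η.fst)⟩

/-- One step of the iteration, written with subgradients. -/
structure IsResolventStep (τ σ : ℝ) (g ρ : E → EReal) (η η' : PrimalDual E) : Prop where
  fst_mem : τ⁻¹ • (η.fst - η'.fst) - η.snd ∈ subdiff g η'.fst
  snd_mem : σ⁻¹ • (η.snd - η'.snd) + ((2 : ℝ) • η'.fst - η.fst) ∈
    subdiff (conjugate ρ) η'.snd

theorem IsDRSRun.isResolventStep (hg : IsProper g) (hgc : IsConvexFun g)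
    (hρ : IsProper (conjugate ρ)) (hρc : IsConvexFun (conjugate ρ)) (hτ : 0 < τ) (hσ : 0 < σ)
    {η : ℕ → PrimalDual E} (h : IsDRSRun τ σ g ρ η) (k : ℕ) :
    IsResolventStep τ σ g ρ (η k) (η (k + 1)) := by
  obtain ⟨h1, h2⟩ := h k
  refine ⟨?_, ?_⟩
  · have := h1.mem_subdiff hg hgc hτ
    rwa [sub_right_comm, smul_sub, inv_smul_smul₀ hτ.ne'] at this
  · have := h2.mem_subdiff hρ hρc hσ
    rwa [add_sub_right_comm, smul_add, inv_smul_smul₀ hσ.ne'] at this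

theorem existsUnique_isDRSRun (hg : IsProper g) (hgc : IsConvexFun g)
    (hρ : IsProper (conjugate ρ)) (hρc : IsConvexFun (conjugate ρ)) (hτ : 0 < τ) (hσ : 0 < σ)
    (hproxg : ∀ v, ∃ p, IsProx τ g v p) (hproxρ : ∀ v, ∃ p, IsProx σ (conjugate ρ) v p)
    (η₀ : PrimalDual E) : ∃! η : ℕ → PrimalDual E, η 0 = η₀ ∧ IsDRSRun τ σ g ρ η := by
  choose P hP using hproxg
  choose Q hQ using hproxρ
  let Z : PrimalDual E → E := fun η => P (η.fst - τ • η.snd)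
  let T : PrimalDual E → PrimalDual E := fun η =>
    WithLp.toLp 2 (Z η, Q (η.snd + σ • ((2 : ℝ) • Z η - η.fst)))
  refine ⟨fun k => T^[k] η₀, ⟨rfl, fun k => ?_⟩, ?_⟩
  · simp only [Function.iterate_succ_apply']
    exact ⟨hP _, hQ _⟩
  · rintro η ⟨h0, h⟩
    funext k
    induction k with
    | zero => exact h0
    | succ k ih =>
      have h1 : (η (k + 1)).fst = Z (η k) := (h k).1.unique hg hgc hτ (hP _)
      have h2 : (η (k + 1)).snd = Q ((η k).snd + σ • ((2 : ℝ) • Z (η k) - (η k).fst)) := by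
        refine IsProx.unique hρ hρc hσ ?_ (hQ _)
        have := (h k).2
        rwa [h1] at this
      simp only [Function.iterate_succ_apply'] at ih ⊢
      rw [← ih]
      exact primalDual_ext h1 h2

theorem inner_opH_sub_opM (η : PrimalDual E) : inner ℝ η (opH τ σ η - opM η)
    = τ⁻¹ * ‖η.fst‖ ^ 2 - 2 * inner ℝ η.fst η.snd + σ⁻¹ * ‖η.snd‖ ^ 2 := by
  rw [WithLp.prod_inner_apply]
  show inner ℝ η.fst (τ⁻¹ • η.fst - η.snd)
    + inner ℝ η.snd (-((2 : ℝ) • η.fst) + σ⁻¹ • η.snd - -η.fst) = _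
  simp only [inner_sub_right, inner_add_right, inner_neg_right, real_inner_smul_right,
    real_inner_self_eq_norm_sq]
  rw [real_inner_comm η.fst η.snd]
  ring

/-- Completing the square writes the form as `‖a • z - a⁻¹ • ζ‖ ^ 2 + (σ⁻¹ - τ) * ‖ζ‖ ^ 2` with `a ^
2 = τ⁻¹`. The isomorphism `B` transports the iteration to the Euclidean norm. -/
theorem normHM_eq_norm_equiv [FiniteDimensional ℝ E] (hτ : 0 < τ) (hσ : 0 < σ)
    (hτσ : τ * σ < 1) :
    ∃ B : PrimalDual E ≃L[ℝ] PrimalDual E, ∀ η, normHM τ σ η = ‖B η‖ ∧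
      normHM τ σ η ^ 2 = inner ℝ η (opH τ σ η - opM η) := by
  set a := Real.sqrt τ⁻¹ with ha
  set b := Real.sqrt (σ⁻¹ - τ) with hb
  have ha0 : 0 < a := Real.sqrt_pos.2 (inv_pos.2 hτ)
  have hb' : 0 < σ⁻¹ - τ := by
    rwa [sub_pos, inv_eq_one_div, lt_div_iff₀ hσ]
  have hb0 : 0 < b := Real.sqrt_pos.2 hb'
  have ha2 : a ^ 2 = τ⁻¹ := Real.sq_sqrt (inv_pos.2 hτ).le
  have hb2 : b ^ 2 = σ⁻¹ - τ := Real.sq_sqrt hb'.le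
  let B : PrimalDual E →ₗ[ℝ] PrimalDual E :=
    { toFun := fun η => WithLp.toLp 2 (a • η.fst - a⁻¹ • η.snd, b • η.snd)
      map_add' := fun x y => primalDual_ext
        (show a • (x.fst + y.fst) - a⁻¹ • (x.snd + y.snd)
          = (a • x.fst - a⁻¹ • x.snd) + (a • y.fst - a⁻¹ • y.snd) by module)
        (show b • (x.snd + y.snd) = b • x.snd + b • y.snd by module)
      map_smul' := fun c x => primalDual_ext
        (show a • (c • x.fst) - a⁻¹ • (c • x.snd) = c • (a • x.fst - a⁻¹ • x.snd) by module)
        (show b • (c • x.snd) = c • (b • x.snd) by module) }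
  have hB1 : ∀ η, (B η).fst = a • η.fst - a⁻¹ • η.snd := fun _ => rfl
  have hB2 : ∀ η, (B η).snd = b • η.snd := fun _ => rfl
  have hinj : Function.Injective B := by
    rw [injective_iff_map_eq_zero]
    intro η hη
    have h1 := hB1 η
    have h2 := hB2 η
    rw [hη] at h1 h2
    have h3 : η.snd = 0 := (smul_eq_zero.1 h2.symm).resolve_left hb0.ne'
    rw [h3, smul_zero, sub_zero] at h1
    have h4 : η.fst = 0 := (smul_eq_zero.1 h1.symm).resolve_left ha0.ne'
    exact primalDual_ext h4 h3
  refine ⟨(LinearEquiv.ofInjectiveEndo B hinj).toContinuousLinearEquiv, fun η => ?_⟩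
  have h : inner ℝ η (opH τ σ η - opM η) = ‖B η‖ ^ 2 := by
    rw [inner_opH_sub_opM, WithLp.prod_norm_sq_eq_of_L2, hB1, hB2, norm_sub_sq_real, norm_smul,
      norm_smul, norm_smul, real_inner_smul_left, real_inner_smul_right, mul_pow, mul_pow,
      mul_pow, Real.norm_eq_abs, Real.norm_eq_abs, Real.norm_eq_abs, sq_abs, sq_abs, sq_abs, hb2,
      inv_pow, ha2, inv_inv, ← mul_assoc a, mul_inv_cancel₀ ha0.ne']
    ring
  have hn : normHM τ σ η = ‖B η‖ := by rw [normHM, h, Real.sqrt_sq (norm_nonneg _)]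
  exact ⟨hn, by rw [hn, h]⟩

/-- Firm nonexpansiveness of a step in the norm of `H - M`. -/
theorem IsResolventStep.fejer [FiniteDimensional ℝ E] (hg : ∀ x, g x ≠ ⊥)
    (hρ : ∀ x, conjugate ρ x ≠ ⊥) (hτ : 0 < τ) (hσ : 0 < σ) (hτσ : τ * σ < 1)
    {η η' p : PrimalDual E} (h : IsResolventStep τ σ g ρ η η')
    (hp : IsPrimalDualSolution g ρ p) :
    normHM τ σ (η' - p) ^ 2 + normHM τ σ (η - η') ^ 2 ≤ normHM τ σ (η - p) ^ 2 := by
  rw [isPrimalDualSolution_iff] at hp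
  obtain ⟨B, hB⟩ := normHM_eq_norm_equiv (E := E) hτ hσ hτσ
  have hsq : ∀ θ : PrimalDual E, normHM τ σ θ ^ 2
      = τ⁻¹ * ‖θ.fst‖ ^ 2 - 2 * inner ℝ θ.fst θ.snd + σ⁻¹ * ‖θ.snd‖ ^ 2 := by
    intro θ
    rw [(hB θ).2, inner_opH_sub_opM]
  set δ := η.fst - η'.fst with hδ
  set θ := η.snd - η'.snd with hθ
  set e := η'.fst - p.fst with he
  set f := η'.snd - p.snd with hf
  have m1 := subdiff_monotone hg h.fst_mem hp.1
  have m2 := subdiff_monotone hρ h.snd_mem hp.2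
  have e1 : τ⁻¹ • δ - η.snd - -p.snd = τ⁻¹ • δ - θ - f := by rw [hθ, hf]; abel
  have e2 : σ⁻¹ • θ + ((2 : ℝ) • η'.fst - η.fst) - p.fst = σ⁻¹ • θ + e - δ := by
    rw [he, hδ, two_smul]; abel
  rw [e1] at m1
  rw [e2] at m2
  have e3 : (η - p).fst = δ + e := by rw [WithLp.sub_fst, hδ, he]; abel
  have e4 : (η - p).snd = θ + f := by rw [WithLp.sub_snd, hθ, hf]; abel
  rw [hsq, hsq, hsq, e3, e4]
  simp only [WithLp.sub_fst, WithLp.sub_snd, ← hδ, ← hθ, ← he, ← hf]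
  rw [norm_add_sq_real, norm_add_sq_real]
  simp only [inner_sub_left, inner_add_left, real_inner_smul_left, inner_add_right] at m1 m2 ⊢
  rw [real_inner_comm θ e, real_inner_comm f e] at *
  linarith

end Iteration

/-! ### Linear convergence for linear constraints and a piecewise linear-quadratic objective -/

noncomputable section LinearConvergence

variable {E : Type*} [NormedAddCommGroup E] [InnerProductSpace ℝ E] [FiniteDimensional ℝ E]
  {Y : Type*} [NormedAddCommGroup Y] [NormedSpace ℝ Y] {L : E →ₗ[ℝ] Y} {w : Y} {ρ : E → EReal}
  {𝒟 : PLQData E} {τ σ : ℝ}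

theorem isPrimalDualSolution_affineIndicator_iff (hρ : IsProper ρ) (hconv : IsConvexFun ρ)
    (hcl : IsClosed {p : E × ℝ | ρ p.1 ≤ (p.2 : EReal)}) {x₀ ζ₀ : E} (h₀ : ζ₀ ∈ subdiff ρ x₀)
    {η : PrimalDual E} : IsPrimalDualSolution (affineIndicator L w) ρ η ↔
      L η.fst = w ∧ η.snd ∈ (LinearMap.ker L)ᗮ ∧ η.snd ∈ subdiff ρ η.fst := by
  rw [isPrimalDualSolution_iff, mem_subdiff_affineIndicator, neg_mem_iff,
    mem_subdiff_conjugate_iff hρ hconv hcl h₀, and_assoc]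

theorem isClosed_primalDualSolutions (hρ : IsProper ρ) (hconv : IsConvexFun ρ)
    (hcl : IsClosed {p : E × ℝ | ρ p.1 ≤ (p.2 : EReal)}) {x₀ ζ₀ : E} (h₀ : ζ₀ ∈ subdiff ρ x₀) :
    IsClosed {η | IsPrimalDualSolution (affineIndicator L w) ρ η} := by
  refine IsSeqClosed.isClosed fun η ηs h hlim => ?_
  have h1 : Tendsto (fun k => (η k).fst) atTop (𝓝 ηs.fst) :=
    ((WithLp.fstL 2 ℝ E E).continuous.tendsto _).comp hlim
  have h2 : Tendsto (fun k => (η k).snd) atTop (𝓝 ηs.snd) :=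
    ((WithLp.sndL 2 ℝ E E).continuous.tendsto _).comp hlim
  have hη := fun k => (isPrimalDualSolution_affineIndicator_iff hρ hconv hcl h₀).1 (h k)
  refine (isPrimalDualSolution_affineIndicator_iff hρ hconv hcl h₀).2 ⟨?_, ?_, ?_⟩
  · have h3 := (L.continuous_of_finiteDimensional.tendsto _).comp h1
    refine tendsto_nhds_unique h3 ?_
    simp only [Function.comp_def, (hη _).1, tendsto_const_nhds]
  · exact (Submodule.isClosed_orthogonal _).mem_of_tendsto h2
      (Eventually.of_forall fun k => (hη k).2.1)
  · exact mem_subdiff_of_tendsto hρ hcl h1 h2 fun k => (hη k).2.2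

/-- The length of a short step bounds the distance to the primal-dual solutions. -/
theorem exists_primalDualSolution_near [FiniteDimensional ℝ Y] (hR : 𝒟.Represents ρ)
    (hρ : IsProper ρ) (hconv : IsConvexFun ρ) {x₀ ζ₀ : E} (h₀ : ζ₀ ∈ subdiff ρ x₀) :
    ∃ ε C : ℝ, 0 < ε ∧ 0 ≤ C ∧ ∀ η η', IsResolventStep τ σ (affineIndicator L w) ρ η η' →
      ‖η - η'‖ < ε → ∃ p, IsPrimalDualSolution (affineIndicator L w) ρ p ∧
        ‖η - p‖ ≤ C * ‖η - η'‖ := by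
  have hcl := hR.isClosed_epigraph
  -- On the graph of `∂ρ`, the fibre of `Φ` over `(w, 0)` is exactly the set of primal-dual
  -- solutions.
  let Φ : E × E →ₗ[ℝ] Y × E := L.prodMap (LinearMap.ker L).starProjection.toLinearMap
  obtain ⟨ε, C, hε, hC0, hC⟩ := hR.exists_error_bound hρ hconv Φ (w, 0)
  set K := ‖Φ.toContinuousLinearMap‖ with hK
  have hK0 : 0 ≤ K := norm_nonneg Φ.toContinuousLinearMap
  set m := max (|σ⁻¹| + 1) (|τ⁻¹| + 1) with hm
  have hm1 : |σ⁻¹| + 1 ≤ m := le_max_left _ _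
  have hm2 : |τ⁻¹| + 1 ≤ m := le_max_right _ _
  have hm0 : 0 < m := by have := abs_nonneg σ⁻¹; linarith
  refine ⟨ε / (K * m + 1), 1 + (2 * (C * (K * m)) + m), by positivity, by positivity,
    fun η η' h hlt => ?_⟩
  rw [lt_div_iff₀ (by positivity)] at hlt
  obtain ⟨hz', hu⟩ := mem_subdiff_affineIndicator.1 h.fst_mem
  have hx := (mem_subdiff_conjugate_iff hρ hconv hcl h₀).1 h.snd_mem
  set s := ‖η - η'‖ with hs
  have hs0 : 0 ≤ s := norm_nonneg _
  have hδ : ‖η.fst - η'.fst‖ ≤ s := WithLp.norm_fst_le _ (η - η')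
  have hθ : ‖η.snd - η'.snd‖ ≤ s := WithLp.norm_snd_le _ (η - η')
  set δ := η.fst - η'.fst with hδdef
  set θ := η.snd - η'.snd with hθdef
  -- The new dual iterate is a subgradient of `ρ` at this auxiliary point, which differs from the
  -- new primal iterate by terms of the order of the step.
  set x := σ⁻¹ • θ + ((2 : ℝ) • η'.fst - η.fst) with hxdef
  have hxe : x = η'.fst + (σ⁻¹ • θ - δ) := by rw [hxdef, hδdef, two_smul]; abel
  have hζe : η'.snd = -(τ⁻¹ • δ - η.snd) + (τ⁻¹ • δ - θ) := by rw [hθdef]; abel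
  have hc1 : ‖σ⁻¹ • θ - δ‖ ≤ m * s := by
    refine (norm_sub_le _ _).trans ?_
    rw [norm_smul, Real.norm_eq_abs]
    have := mul_le_mul_of_nonneg_left hθ (abs_nonneg σ⁻¹)
    have := mul_le_mul_of_nonneg_right hm1 hs0
    linarith
  have hc2 : ‖τ⁻¹ • δ - θ‖ ≤ m * s := by
    refine (norm_sub_le _ _).trans ?_
    rw [norm_smul, Real.norm_eq_abs]
    have := mul_le_mul_of_nonneg_left hδ (abs_nonneg τ⁻¹)
    have := mul_le_mul_of_nonneg_right hm2 hs0
    linarith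
  -- The new primal iterate and the negative of its subgradient of the indicator solve the equation
  -- exactly; only the corrections remain.
  have hres : Φ (x, η'.snd) - (w, 0) = Φ (σ⁻¹ • θ - δ, τ⁻¹ • δ - θ) := by
    have h1 : Φ (η'.fst, -(τ⁻¹ • δ - η.snd)) = (w, 0) := by
      refine Prod.ext hz' ?_
      exact (Submodule.starProjection_apply_eq_zero_iff _).2 (Submodule.neg_mem _ hu)
    rw [hxe]
    conv_lhs => rw [hζe]
    rw [← Prod.mk_add_mk, map_add, h1, add_sub_cancel_left]
  have hnorm : ‖Φ (x, η'.snd) - (w, 0)‖ ≤ K * m * s := by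
    rw [hres, mul_assoc]
    refine (Φ.toContinuousLinearMap.le_opNorm _).trans ?_
    gcongr
    exact max_le hc1 hc2
  obtain ⟨x', ζ', hζ', hΦ, hd1, hd2⟩ := hC x η'.snd hx (by nlinarith)
  have hLx : L x' = w := congrArg Prod.fst hΦ
  have hPζ : (LinearMap.ker L).starProjection ζ' = 0 := congrArg Prod.snd hΦ
  refine ⟨WithLp.toLp 2 (x', ζ'), (isPrimalDualSolution_affineIndicator_iff hρ hconv hcl h₀).2
    ⟨hLx, (Submodule.starProjection_apply_eq_zero_iff _).1 hPζ, hζ'⟩, ?_⟩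
  have hd1' := hd1.trans (mul_le_mul_of_nonneg_left hnorm hC0)
  have hd2' := hd2.trans (mul_le_mul_of_nonneg_left hnorm hC0)
  have h1 : ‖η'.fst - x'‖ ≤ C * (K * m * s) + m * s := by
    have h2 : η'.fst - x' = (x - x') - (σ⁻¹ • θ - δ) := by rw [hxe]; abel
    rw [h2]
    exact (norm_sub_le _ _).trans (add_le_add hd1' hc1)
  have h2 : ‖η' - WithLp.toLp 2 (x', ζ')‖ ≤ ‖η'.fst - x'‖ + ‖η'.snd - ζ'‖ := by
    refine abs_le_of_sq_le_sq' ?_ (by positivity) |>.2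
    rw [WithLp.prod_norm_sq_eq_of_L2]
    show ‖η'.fst - x'‖ ^ 2 + ‖η'.snd - ζ'‖ ^ 2 ≤ _
    have := mul_nonneg (norm_nonneg (η'.fst - x')) (norm_nonneg (η'.snd - ζ'))
    nlinarith
  have h3 := norm_sub_le_norm_sub_add_norm_sub η η' (WithLp.toLp 2 (x', ζ'))
  linarith

theorem exists_linear_convergence [FiniteDimensional ℝ Y] (hR : 𝒟.Represents ρ)
    (hρ : IsProper ρ) (hconv : IsConvexFun ρ) (hτ : 0 < τ) (hσ : 0 < σ) (hτσ : τ * σ < 1)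
    {x₀ ζ₀ : E} (hx₀ : L x₀ = w) (hζ₀ : ζ₀ ∈ (LinearMap.ker L)ᗮ) (h₀ : ζ₀ ∈ subdiff ρ x₀) :
    ∃ R κ c : ℝ, 0 < R ∧ 0 < κ ∧ κ < 1 ∧ 0 < c ∧
      ∀ η : ℕ → PrimalDual E,
        (∀ k, IsResolventStep τ σ (affineIndicator L w) ρ (η k) (η (k + 1))) →
        ∃ ηs, IsPrimalDualSolution (affineIndicator L w) ρ ηs ∧ Tendsto η atTop (𝓝 ηs) ∧
          ∀ K : ℕ, ‖η K - ηs‖ < R →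
            (∀ k, K ≤ k → normHM τ σ (η (k + 1) - ηs) ≤ κ * normHM τ σ (η k - ηs)) ∧
            (∀ k, K ≤ k → ‖η k - ηs‖ ≤ c * κ ^ (k - K) * ‖η K - ηs‖) := by
  have hcl := hR.isClosed_epigraph
  obtain ⟨ε, C, hε, hC0, hC⟩ := exists_primalDualSolution_near (τ := τ) (σ := σ) (L := L) (w := w)
    hR hρ hconv h₀
  obtain ⟨B, hB⟩ := normHM_eq_norm_equiv (E := E) hτ hσ hτσ
  set a := ‖(B : PrimalDual E →L[ℝ] PrimalDual E)‖ with ha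
  set b := ‖(B.symm : PrimalDual E →L[ℝ] PrimalDual E)‖ with hb
  have ha0 : 0 ≤ a := norm_nonneg (B : PrimalDual E →L[ℝ] PrimalDual E)
  have hb0 : 0 ≤ b := norm_nonneg (B.symm : PrimalDual E →L[ℝ] PrimalDual E)
  have hBa : ∀ v, ‖B v‖ ≤ a * ‖v‖ := (B : PrimalDual E →L[ℝ] PrimalDual E).le_opNorm
  have hBb : ∀ v, ‖v‖ ≤ b * ‖B v‖ := fun v => by
    simpa using (B.symm : PrimalDual E →L[ℝ] PrimalDual E).le_opNorm (B v)
  -- Error constant after transport by `B` and back; the summand `1` secures `1 ≤ C'`.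
  set C' := a * C * b + 1 with hC'
  have hC'1 : 1 ≤ C' := by
    have : 0 ≤ a * C * b := by positivity
    linarith
  set ε' := ε / (b + 1) with hε'
  have hε'0 : 0 < ε' := by positivity
  set κ := Real.sqrt (1 - 1 / (4 * C' ^ 2)) with hκ
  have hq : 0 < 1 / (4 * C' ^ 2) := by positivity
  have hq1 : 1 / (4 * C' ^ 2) < 1 := by
    rw [div_lt_one (by positivity)]; nlinarith
  have hκ0 : 0 < κ := Real.sqrt_pos.2 (by linarith)
  have hκ1 : κ < 1 := by
    rw [hκ, Real.sqrt_lt' one_pos]; linarith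
  refine ⟨ε' / (a + 1), κ, b * a + 1, by positivity, hκ0, hκ1, by positivity,
    fun η hη => ?_⟩
  set S := {η | IsPrimalDualSolution (affineIndicator L w) ρ η} with hS
  have hScl : IsClosed (B '' S) :=
    B.toHomeomorph.isClosedMap _ (isClosed_primalDualSolutions hρ hconv hcl h₀)
  have hSne : (B '' S).Nonempty := ⟨_, WithLp.toLp 2 (x₀, ζ₀),
    (isPrimalDualSolution_affineIndicator_iff hρ hconv hcl h₀).2 ⟨hx₀, hζ₀, h₀⟩, rfl⟩
  obtain ⟨_, ⟨ηs, hηs, rfl⟩, hlim, hcontr⟩ := fejer_linear_convergence (ξ := fun k => B (η k))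
    hScl hSne (by
      rintro k _ ⟨p, hp, rfl⟩
      have := (hη k).fejer affineIndicator_ne_bot (conjugate_ne_bot hρ) hτ hσ hτσ hp
      simpa only [(hB _).1, map_sub] using this) hε'0 hC'1 (by
      intro k hk
      rw [← map_sub] at hk
      rw [hε', lt_div_iff₀ (by positivity)] at hk
      have h1 := hBb (η k - η (k + 1))
      have h2 := norm_nonneg (B (η k - η (k + 1)))
      obtain ⟨p, hp, hpd⟩ := hC _ _ (hη k) (by nlinarith)
      refine ⟨B p, ⟨p, hp, rfl⟩, ?_⟩
      rw [← map_sub, ← map_sub]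
      calc ‖B (η k - p)‖ ≤ a * (C * (b * ‖B (η k - η (k + 1))‖)) :=
            (hBa _).trans (by gcongr; exact hpd.trans (by gcongr))
        _ ≤ C' * ‖B (η k - η (k + 1))‖ := by rw [hC']; nlinarith)
  refine ⟨ηs, hηs, ?_, fun K hK => ?_⟩
  · have := (B.symm.continuous.tendsto _).comp hlim
    simpa [Function.comp_def] using this
  · simp only [← map_sub] at hcontr
    have hstart : ‖B (η K - ηs)‖ < ε' := by
      rw [lt_div_iff₀ (by positivity)] at hK
      have := hBa (η K - ηs)
      have := norm_nonneg (η K - ηs)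
      nlinarith
    -- Staying in the ball is part of the induction, since the contraction is only local.
    have hpow : ∀ k, K ≤ k → ‖B (η k - ηs)‖ ≤ κ ^ (k - K) * ‖B (η K - ηs)‖ ∧
        ‖B (η k - ηs)‖ < ε' := by
      intro k hk
      induction k, hk using Nat.le_induction with
      | base => simpa using hstart
      | succ k hk ih =>
        have h1 := hcontr k ih.2
        have h2 := norm_nonneg (B (η k - ηs))
        refine ⟨?_, by nlinarith⟩
        rw [Nat.succ_sub hk, pow_succ', mul_assoc]
        exact h1.trans (mul_le_mul_of_nonneg_left ih.1 hκ0.le)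
    refine ⟨fun k hk => ?_, fun k hk => ?_⟩
    · rw [(hB _).1, (hB _).1]
      exact hcontr k (hpow k hk).2
    · have h1 : 0 ≤ κ ^ (k - K) * ‖η K - ηs‖ := by positivity
      calc ‖η k - ηs‖ ≤ b * (κ ^ (k - K) * (a * ‖η K - ηs‖)) :=
            (hBb _).trans (by
              gcongr
              exact (hpow k hk).1.trans (by gcongr; exact hBa _))
        _ ≤ (b * a + 1) * κ ^ (k - K) * ‖η K - ηs‖ := by nlinarith

end LinearConvergence

/-! ### Specialization to Kalman smoothing -/

namespace KalmanModel

variable {n m N : ℕ} (S : KalmanModel n m N)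

/-- The constraint matrix as a linear map. -/
noncomputable def constraintMap : ZSpace n m N →ₗ[ℝ] (Fin N × (Fin n ⊕ Fin m) → ℝ) :=
  S.A.mulVecLin.comp (WithLp.linearEquiv 2 ℝ (Fin N × StageIdx n m → ℝ)).toLinearMap

theorem constraintMap_eq_iff {z : ZSpace n m N} : S.constraintMap z = S.w ↔ S.Feasible z :=
  Iff.rfl

theorem g_eq_affineIndicator : S.g = affineIndicator S.constraintMap S.w := by
  funext z
  unfold g affineIndicator
  by_cases h : S.Feasible z
  · rw [if_pos h, if_pos (S.constraintMap_eq_iff.2 h)]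
  · rw [if_neg h, if_neg (mt S.constraintMap_eq_iff.1 h)]

end KalmanModel

theorem theorem2 {n m N : ℕ} (S : KalmanModel n m N)
    (ρ₁ : Fin N → EuclideanSpace ℝ (Fin n) → EReal)
    (ρ₂ : Fin N → EuclideanSpace ℝ (Fin m) → EReal)
    (ρ₃ : Fin N → EuclideanSpace ℝ (Fin n) → EReal)
    (hproper : IsProper (objective ρ₁ ρ₂ ρ₃))
    (hconvex : IsConvexFun (objective ρ₁ ρ₂ ρ₃))
    (hplq : IsPLQ (objective ρ₁ ρ₂ ρ₃))
    (hsol : ∃ z, S.IsSolution (objective ρ₁ ρ₂ ρ₃) z)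
    (τ σ : ℝ) (hτ : 0 < τ) (hτ1 : τ < 1) (hσ : 0 < σ) (hσ1 : σ < 1) :
    (∀ η₀ : PrimalDual (ZSpace n m N),
      ∃! η : ℕ → PrimalDual (ZSpace n m N),
        η 0 = η₀ ∧ IsDRSRun τ σ S.g (objective ρ₁ ρ₂ ρ₃) η) ∧
    ∃ R κ c : ℝ, 0 < R ∧ 0 < κ ∧ κ < 1 ∧ 0 < c ∧
      ∀ η : ℕ → PrimalDual (ZSpace n m N), IsDRSRun τ σ S.g (objective ρ₁ ρ₂ ρ₃) η →
        ∃ ηs : PrimalDual (ZSpace n m N),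
          IsPrimalDualSolution S.g (objective ρ₁ ρ₂ ρ₃) ηs ∧
          S.IsSolution (objective ρ₁ ρ₂ ρ₃) ηs.fst ∧
          Tendsto η atTop (𝓝 ηs) ∧
          ∀ K : ℕ, ‖η K - ηs‖ < R →
            (∀ k, K ≤ k → normHM τ σ (η (k + 1) - ηs) ≤ κ * normHM τ σ (η k - ηs)) ∧
            (∀ k, K ≤ k → ‖η k - ηs‖ ≤ c * κ ^ (k - K) * ‖η K - ηs‖) := by
  rw [S.g_eq_affineIndicator]
  generalize objective ρ₁ ρ₂ ρ₃ = ρ at hproper hconvex hplq hsol ⊢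
  obtain ⟨𝒟, hR⟩ := hplq.exists_data
  have hcl := hR.isClosed_epigraph
  obtain ⟨z₀, hz₀, hz₀top, hz₀min⟩ := hsol
  -- This multiplier makes the solution set nonempty, and as a subgradient it also gives `ρ` and its
  -- conjugate the affine minorants needed for proximal points.
  obtain ⟨ζ₀, h₀, hζ₀⟩ := hR.exists_orthogonal_subgradient hproper.1 hconvex
    (LinearMap.ker S.constraintMap) hz₀top fun d hd => hz₀min _ (by
      rw [← S.constraintMap_eq_iff, map_add, LinearMap.mem_ker.1 hd, add_zero]
      exact hz₀)
  have hg : IsProper (affineIndicator S.constraintMap S.w) := isProper_affineIndicator hz₀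
  have hgsub : (0 : ZSpace n m N) ∈ subdiff (affineIndicator S.constraintMap S.w) z₀ :=
    mem_subdiff_affineIndicator.2 ⟨hz₀, Submodule.zero_mem _⟩
  have hρs : IsProper (conjugate ρ) := isProper_conjugate hproper h₀
  have hρsc := isConvexFun_conjugate hproper.1
  refine ⟨existsUnique_isDRSRun hg isConvexFun_affineIndicator hρs hρsc hτ hσ
    (exists_isProx_of_mem_subdiff hg isClosed_epigraph_affineIndicator hgsub hτ)
    (exists_isProx_of_mem_subdiff hρs (isClosed_epigraph_conjugate hproper.1)
      (mem_subdiff_conjugate hproper h₀) hσ), ?_⟩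
  obtain ⟨R, κ, c, hR0, hκ0, hκ1, hc, H⟩ := exists_linear_convergence hR hproper hconvex hτ hσ
    (by nlinarith) (L := S.constraintMap) (w := S.w) hz₀ hζ₀ h₀
  refine ⟨R, κ, c, hR0, hκ0, hκ1, hc, fun η hη => ?_⟩
  obtain ⟨ηs, hηs, hlim, hK⟩ := H η
    (hη.isResolventStep hg isConvexFun_affineIndicator hρs hρsc hτ hσ)
  refine ⟨ηs, hηs, ?_, hlim, hK⟩
  obtain ⟨hfeas, hort, hsub⟩ :=
    (isPrimalDualSolution_affineIndicator_iff hproper hconvex hcl h₀).1 hηs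
  refine ⟨hfeas, hsub.1, fun z' hz' => ?_⟩
  have h1 : z' - ηs.fst ∈ LinearMap.ker S.constraintMap := by
    rw [LinearMap.mem_ker, map_sub, hfeas, S.constraintMap_eq_iff.2 hz', sub_self]
  have h2 := hsub.2.2 z'
  rwa [(Submodule.mem_orthogonal' _ _).1 hort _ h1, EReal.coe_zero, add_zero] at h2
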